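/- Let $n \ge 0$ and let $\Gamma \le \mathrm{GL}_n(\mathbb{R})$ be a subgroup whose set of traces $\{\operatorname{tr}(\gamma) : \gamma \in \Gamma\}$ is bounded. Let $G \le \mathrm{GL}_n(\mathbb{R})$ be the real Zariski closure of $\Gamma$, i.e. the group of all $g \in \mathrm{GL}_n(\mathbb{R})$ at which every polynomial in the matrix entries that vanishes on $\Gamma$ vanishes, with the topology inherited from $\mathrm{GL}_n(\mathbb{R})$. Then $G$ is amenable (there is a left-invariant mean on the bounded continuous real functions on $G$). Moreover, let $U$ be the unipotent radical of $G$, i.e. the subgroup generated by all normal subgroups of $G$ consisting of unipotent matrices. Then $U$ itself consists of unipotent matrices (so it is the largest unipotent normal subgroup of $G$), $U$ is Zariski closed in $\mathrm{GL}_n(\mathbb{R})$, and the quotient group $G/U$ is compact. -/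

import Mathlib

open scoped MatrixGroups BoundedContinuousFunction

/-- The point of affine `n²`-space given by the entries of an invertible real matrix. -/
def glEntries {n : ℕ} (g : GL (Fin n) ℝ) : Fin n × Fin n → ℝ :=
  fun ij => g.val ij.1 ij.2

/-- The real Zariski closure of a subset `S` of `GL n ℝ`: all real invertible matrices at which
every polynomial in the matrix entries that vanishes on `S` vanishes. (Allowing complex
coefficients, or division by powers of the determinant, gives the same set.) -/
def zariskiClosureSet {n : ℕ} (S : Set (GL (Fin n) ℝ)) : Set (GL (Fin n) ℝ) :=
  {g | glEntries g ∈ MvPolynomial.zeroLocus ℝ (MvPolynomial.vanishingIdeal ℝ (glEntries '' S))}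

theorem mem_zariskiClosureSet {n : ℕ} {S : Set (GL (Fin n) ℝ)} {g : GL (Fin n) ℝ} :
    g ∈ zariskiClosureSet S ↔ ∀ p : MvPolynomial (Fin n × Fin n) ℝ,
      (∀ s ∈ S, MvPolynomial.aeval (glEntries s) p = 0) →
        MvPolynomial.aeval (glEntries g) p = 0 := by
  simp [zariskiClosureSet]

/-- A subset of `GL n ℝ` is Zariski closed if it equals its real Zariski closure. -/
def IsZariskiClosed {n : ℕ} (S : Set (GL (Fin n) ℝ)) : Prop :=
  zariskiClosureSet S = S

/-- Left and right translations are polynomial. -/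
theorem exists_translate_poly {n : ℕ} (a b : GL (Fin n) ℝ)
    (p : MvPolynomial (Fin n × Fin n) ℝ) :
    ∃ q : MvPolynomial (Fin n × Fin n) ℝ, ∀ g : GL (Fin n) ℝ,
      MvPolynomial.aeval (glEntries g) q = MvPolynomial.aeval (glEntries (a * g * b)) p := by
  refine ⟨MvPolynomial.bind₁ (fun ij => ∑ l, (∑ k, MvPolynomial.C (a.val ij.1 k) *
    MvPolynomial.X (k, l)) * MvPolynomial.C (b.val l ij.2)) p, fun g => ?_⟩
  rw [MvPolynomial.aeval_bind₁]
  congr 2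
  funext ij
  simp [glEntries, Matrix.mul_apply]

/-- Inversion is polynomial up to a power of the determinant. -/
theorem exists_inv_poly {n : ℕ} (p : MvPolynomial (Fin n × Fin n) ℝ) :
    ∃ (N : ℕ) (q : MvPolynomial (Fin n × Fin n) ℝ), ∀ g : GL (Fin n) ℝ,
      MvPolynomial.aeval (glEntries g) q =
        g.val.det ^ N * MvPolynomial.aeval (glEntries g⁻¹) p := by
  have hmap : ∀ g : GL (Fin n) ℝ,
      (MvPolynomial.aeval (glEntries g)).toRingHom.mapMatrix
        (Matrix.mvPolynomialX (Fin n) (Fin n) ℝ) = g.val := by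
    intro g
    ext i j
    simp [glEntries, Matrix.mvPolynomialX]
  have hdet : ∀ g : GL (Fin n) ℝ, MvPolynomial.aeval (glEntries g)
      (Matrix.mvPolynomialX (Fin n) (Fin n) ℝ).det = g.val.det := by
    intro g
    have := RingHom.map_det (MvPolynomial.aeval (glEntries g)).toRingHom
      (Matrix.mvPolynomialX (Fin n) (Fin n) ℝ)
    rw [hmap] at this
    exact this
  have hadj : ∀ (g : GL (Fin n) ℝ) (ij : Fin n × Fin n), MvPolynomial.aeval (glEntries g)
      ((Matrix.mvPolynomialX (Fin n) (Fin n) ℝ).adjugate ij.1 ij.2) =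
        g.val.det * glEntries g⁻¹ ij := by
    intro g ij
    have := RingHom.map_adjugate (MvPolynomial.aeval (glEntries g)).toRingHom
      (Matrix.mvPolynomialX (Fin n) (Fin n) ℝ)
    rw [hmap] at this
    have h2 := congrFun (congrFun this ij.1) ij.2
    have h3 : g.val.adjugate = g.val.det • (g⁻¹).val := by
      have h4 : g.val.adjugate * g.val * (g⁻¹).val = g.val.det • (g⁻¹).val := by
        rw [Matrix.adjugate_mul]; simp
      rw [← h4, mul_assoc, ← Units.val_mul]; simp
    rw [h3] at h2
    simpa [glEntries] using h2
  induction p using MvPolynomial.induction_on with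
  | C c => exact ⟨0, MvPolynomial.C c, fun g => by simp⟩
  | add p₁ p₂ h₁ h₂ =>
    obtain ⟨N₁, q₁, h₁⟩ := h₁
    obtain ⟨N₂, q₂, h₂⟩ := h₂
    refine ⟨N₁ + N₂, (Matrix.mvPolynomialX (Fin n) (Fin n) ℝ).det ^ N₂ * q₁ +
      (Matrix.mvPolynomialX (Fin n) (Fin n) ℝ).det ^ N₁ * q₂, fun g => ?_⟩
    rw [map_add, map_mul, map_mul, map_pow, map_pow, hdet, h₁, h₂, map_add]
    ring
  | mul_X p ij h =>
    obtain ⟨N, q, h⟩ := h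
    refine ⟨N + 1, q * (Matrix.mvPolynomialX (Fin n) (Fin n) ℝ).adjugate ij.1 ij.2,
      fun g => ?_⟩
    rw [map_mul, hadj, h, map_mul, MvPolynomial.aeval_X]
    ring

/-- The real Zariski closure of a subgroup of `GL n ℝ`, which is again a subgroup. -/
def zariskiClosure {n : ℕ} (Γ : Subgroup (GL (Fin n) ℝ)) : Subgroup (GL (Fin n) ℝ) where
  carrier := zariskiClosureSet (Γ : Set (GL (Fin n) ℝ))
  one_mem' := mem_zariskiClosureSet.2 fun _ hp => hp 1 Γ.one_mem
  mul_mem' := by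
    intro x y hx hy
    rw [mem_zariskiClosureSet] at hx hy ⊢
    intro p hp
    obtain ⟨q, hq⟩ := exists_translate_poly x 1 p
    simp only [mul_one] at hq
    rw [← hq]
    refine hy q fun s hs => ?_
    obtain ⟨r, hr⟩ := exists_translate_poly 1 s p
    simp only [one_mul] at hr
    rw [hq, ← hr]
    refine hx r fun t ht => ?_
    rw [hr]
    exact hp _ (Γ.mul_mem ht hs)
  inv_mem' := by
    intro x hx
    rw [mem_zariskiClosureSet] at hx ⊢
    intro p hp
    obtain ⟨N, q, hq⟩ := exists_inv_poly p
    have h := hx q fun s hs => by rw [hq, hp _ (Γ.inv_mem hs), mul_zero]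
    rw [hq] at h
    have hd : x.val.det ≠ 0 := ((Matrix.isUnit_iff_isUnit_det _).1 x.isUnit).ne_zero
    exact (mul_eq_zero.1 h).resolve_left (pow_ne_zero _ hd)

/-- A subgroup of a linear group `G ≤ GL n ℝ` is unipotent if `u - 1` is a nilpotent matrix for
each of its elements `u`. -/
def IsUnipotentSubgroup {n : ℕ} {G : Subgroup (GL (Fin n) ℝ)} (U : Subgroup G) : Prop :=
  ∀ u ∈ U, IsNilpotent ((u : GL (Fin n) ℝ).val - 1)

/-- The unipotent radical of a linear group `G ≤ GL n ℝ`: the subgroup generated by all normal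
unipotent subgroups of `G`. (It is the largest such subgroup as soon as it is itself
unipotent.) -/
def unipotentRadical {n : ℕ} (G : Subgroup (GL (Fin n) ℝ)) : Subgroup G :=
  sSup {U : Subgroup G | U.Normal ∧ IsUnipotentSubgroup U}

instance unipotentRadical_normal {n : ℕ} (G : Subgroup (GL (Fin n) ℝ)) :
    (unipotentRadical G).Normal :=
  Subgroup.sSup_normal _ fun _ h => h.1

/-- Left translation `x ↦ f (g * x)` of a bounded continuous function on a topological group. -/
def leftTranslate {G : Type*} [Group G] [TopologicalSpace G] [IsTopologicalGroup G]
    (g : G) (f : G →ᵇ ℝ) : G →ᵇ ℝ :=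
  f.compContinuous ⟨fun x => g * x, continuous_const_mul g⟩

/-- Amenability of a locally compact topological group: there is a left-invariant mean, that is a
positive, normalized, left-translation-invariant linear functional, on the bounded continuous
real functions. -/
def IsAmenable (G : Type*) [Group G] [TopologicalSpace G] [IsTopologicalGroup G] : Prop :=
  ∃ m : (G →ᵇ ℝ) →ₗ[ℝ] ℝ,
    (∀ f : G →ᵇ ℝ, (∀ x, 0 ≤ f x) → 0 ≤ m f) ∧
    m (BoundedContinuousFunction.const G 1) = 1 ∧
    ∀ (g : G) (f : G →ᵇ ℝ), m (leftTranslate g f) = m f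

/-! Let A be the linear span of Γ, an algebra, and J the radical of the form (a, b) ↦ tr(ab) on A.
If x lies in J, the idempotent of ℝ[x] on whose image x is invertible has trace zero, so it vanishes
and x is nilpotent; hence J is a nilpotent ideal (`IsTraceLike.exists_prod_eq_zero`). Every
functional on A that kills J has the form tr(· x), so bounded traces make the action of Γ on A/J
bounded. Γ then preserves a positive definite form there (`Matrix.exists_invariant_form`). The orbit
of 1 lies on a level set of this form, which is a polynomial condition, so G too is bounded modulo J
(`exists_bounded_projection`).

The unipotent radical U is G ∩ (1 + J) (`mem_unipotentRadical_iff`). Nilpotency of J gives one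
inclusion; Kolchin's theorem, itself a consequence of the nilpotency of trace radicals, gives the
other. Unipotency is then immediate, and U is cut out of G by linear equations.

For compactness of G/U, let N = 1 + J. Every g in G is carried into a fixed compact set by some u in
N, but u need not lie in G. Chevalley's theorem provides a vector v whose line G preserves and whose
stabilizer lies in G. Orbit maps of unipotent groups are proper modulo stabilizers
(`IsPolynomialAlong.exists_isCompact_mul_stabilizer`), so u = m s with m in a compact set and s
fixing v. Thus s belongs to N ∩ G = U, and s g stays in a compact set.

Amenability is proved directly from polynomial growth. A word of length k in a compact subset of G
has entries polynomial in k, because it is bounded modulo J and J is nilpotent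
(`exists_entrySum_pow_le`). Haar measure of balls is polynomial in the radius
(`exists_measure_ball_le`), so some powers of a compact set are almost invariant. -/

/-! ### Trace forms, nilpotent radicals and Kolchin's theorem -/

/-- A linear functional on an algebra that behaves like the trace of endomorphisms of a
finite-dimensional space in characteristic zero. -/
structure IsTraceLike {R : Type*} [Ring R] [Algebra ℝ R] (t : R →ₗ[ℝ] ℝ) : Prop where
  comm : ∀ a b, t (a * b) = t (b * a)
  idem : ∀ e, IsIdempotentElem e → t e = 0 → e = 0
  nilp : ∀ a, IsNilpotent a → t a = 0

/-- Characteristic zero enters here: the trace of an idempotent is its rank. -/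
theorem isTraceLike_trace {V : Type*} [AddCommGroup V] [Module ℝ V] [FiniteDimensional ℝ V] :
    IsTraceLike (LinearMap.trace ℝ V) where
  comm := LinearMap.trace_mul_comm ℝ
  idem _ he h := LinearMap.IsIdempotentElem.eq_zero_of_trace_eq_zero he h
  nilp _ h := (LinearMap.isNilpotent_trace_of_isNilpotent h).eq_zero

theorem isTraceLike_matrix_trace {n : ℕ} :
    IsTraceLike (Matrix.traceLinearMap (Fin n) ℝ ℝ) where
  comm := Matrix.trace_mul_comm
  idem e he h := by
    have h1 : IsIdempotentElem (Matrix.toLin' e) := by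
      rw [IsIdempotentElem, Module.End.mul_eq_comp, ← Matrix.toLin'_mul, he]
    have h2 : Matrix.toLin' e = 0 := LinearMap.IsIdempotentElem.eq_zero_of_trace_eq_zero h1
      (by rw [Matrix.trace_toLin'_eq]; exact h)
    exact (LinearEquiv.map_eq_zero_iff _).1 h2
  nilp _ h := (Matrix.isNilpotent_trace_of_isNilpotent h).eq_zero

/-- The reason for an axiomatic trace: the matrix trace restricted to a subalgebra need not be the
trace of its regular representation, yet it keeps these three properties. -/
theorem IsTraceLike.subalgebra {R : Type*} [Ring R] [Algebra ℝ R] {t : R →ₗ[ℝ] ℝ}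
    (ht : IsTraceLike t) (A : Subalgebra ℝ R) : IsTraceLike (t ∘ₗ A.val.toLinearMap) where
  comm a b := ht.comm a b
  idem e he h := Subtype.ext (ht.idem e (congrArg Subtype.val he) h)
  nilp a h := ht.nilp a (h.map A.val)

/-- An element all of whose multiples by polynomials in it have trace zero is nilpotent. -/
theorem IsTraceLike.isNilpotent {R : Type*} [Ring R] [Algebra ℝ R] [FiniteDimensional ℝ R]
    {t : R →ₗ[ℝ] ℝ} (ht : IsTraceLike t) {x : R} (hx : ∀ y, t (x * y) = 0) : IsNilpotent x := by
  have hint : IsIntegral ℝ x := Algebra.IsIntegral.isIntegral x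
  have h0 : minpoly ℝ x ≠ 0 := minpoly.ne_zero hint
  obtain ⟨q, hq, hqX⟩ := Polynomial.exists_eq_pow_rootMultiplicity_mul_and_not_dvd _ h0 0
  rw [Polynomial.C_0, sub_zero] at hq hqX
  set k := Polynomial.rootMultiplicity 0 (minpoly ℝ x)
  -- The exponent k + 1, rather than k, makes the idempotent `e` below a multiple of `x` even when k
  -- = 0. It is the Fitting projection onto the part where `x` is invertible.
  have hcop : IsCoprime ((Polynomial.X : Polynomial ℝ) ^ (k + 1)) q :=
    (((Polynomial.irreducible_X).coprime_iff_not_dvd).2 hqX).pow_left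
  obtain ⟨a, b, hab⟩ := hcop
  have hzero : (Polynomial.aeval x) (Polynomial.X ^ k * q) = 0 := by
    rw [← hq]; exact minpoly.aeval ℝ x
  set e := Polynomial.aeval x (a * Polynomial.X ^ (k + 1))
  have he : IsIdempotentElem e := by
    have : (Polynomial.aeval x) (a * Polynomial.X ^ (k + 1) * (b * q)) = 0 := by
      have : a * Polynomial.X ^ (k + 1) * (b * q)
        = a * b * Polynomial.X * (Polynomial.X ^ k * q) := by ring
      rw [this, map_mul, hzero, mul_zero]
    have h2 : b * q = 1 - a * Polynomial.X ^ (k + 1) := by rw [← hab]; ring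
    rw [h2, mul_sub, mul_one, map_sub, sub_eq_zero, map_mul _ (a * _)] at this
    exact this.symm
  have hte : t e = 0 := by
    have : e = x * Polynomial.aeval x (a * Polynomial.X ^ k) := by
      have h := map_mul (Polynomial.aeval x) Polynomial.X (a * Polynomial.X ^ k)
      rw [Polynomial.aeval_X] at h
      rw [← h]
      exact congrArg _ (by ring)
    rw [this]; exact hx _
  have he0 := ht.idem e he hte
  refine ⟨k, ?_⟩
  have h1 : (Polynomial.X : Polynomial ℝ) ^ k
      = Polynomial.X ^ k * (a * Polynomial.X ^ (k + 1)) + b * (Polynomial.X ^ k * q) := by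
    linear_combination (-Polynomial.X ^ k) * hab
  have h2 := congrArg (Polynomial.aeval x) h1
  rw [map_add, map_mul _ (_ ^ k) (_ * _), map_mul _ b, hzero, mul_zero, add_zero] at h2
  change _ = _ * e at h2
  rw [he0, mul_zero] at h2
  simpa using h2

/-- The radical of the trace form of an algebra is nilpotent. -/
theorem IsTraceLike.exists_prod_eq_zero {R : Type*} [Ring R] [Algebra ℝ R]
    [FiniteDimensional ℝ R] {t : R →ₗ[ℝ] ℝ} (ht : IsTraceLike t) :
    ∃ k : ℕ, ∀ l : List R, (∀ a ∈ l, ∀ b, t (a * b) = 0) → l.length = k → l.prod = 0 := by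
  let J : Ideal R :=
    { carrier := {a | ∀ b, t (a * b) = 0}
      add_mem' := fun ha hb c => by rw [add_mul, map_add, ha, hb, add_zero]
      zero_mem' := fun b => by simp
      smul_mem' := fun c a ha b => by
        rw [smul_eq_mul, mul_assoc, ht.comm, mul_assoc]; exact ha _ }
  have : IsArtinianRing R := IsArtinianRing.of_finite ℝ R
  have hJ : J ≤ Ideal.jacobson ⊥ := by
    intro a ha
    rw [Ideal.mem_jacobson_iff]
    intro y
    -- A left ideal of nilpotent elements lies in the Jacobson radical, which is nilpotent in an
    -- Artinian ring.
    have hn : IsNilpotent (y * a) := ht.isNilpotent (J.mul_mem_left y ha)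
    obtain ⟨z, hz⟩ := hn.isUnit_one_add.exists_left_inv
    refine ⟨z, ?_⟩
    rw [Ideal.mem_bot, ← hz]; noncomm_ring
  obtain ⟨k, hk⟩ := IsArtinianRing.isNilpotent_jacobson_bot (R := R)
  refine ⟨k, fun l hl hlk => ?_⟩
  have : J.IsTwoSided := ⟨fun c ha b => by rw [mul_assoc]; exact ha _⟩
  have key : ∀ l : List R, (∀ a ∈ l, a ∈ J) → l.prod ∈ J ^ l.length := by
    intro l
    induction l with
    | nil => intro _; simp [Submodule.pow_zero, Ideal.one_eq_top]
    | cons a l ih =>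
      intro h
      rw [List.prod_cons, List.length_cons, Ideal.IsTwoSided.pow_succ]
      exact Ideal.mul_mem_mul (h a (by simp)) (ih fun b hb => h b (by simp [hb]))
  have h1 := Ideal.pow_right_mono hJ k (hlk ▸ key l hl)
  rw [hk] at h1
  simpa using h1

/-- **Kolchin's theorem** for a multiplicative family of unipotent elements. -/
theorem IsTraceLike.exists_prod_sub_one_eq_zero {R : Type*} [Ring R] [Algebra ℝ R]
    [FiniteDimensional ℝ R] {t : R →ₗ[ℝ] ℝ} (ht : IsTraceLike t) {N : Type*} [Monoid N]
    (ρ : N →* R) (hρ : ∀ n, IsNilpotent (ρ n - 1)) :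
    ∃ k : ℕ, ∀ l : List N, l.length = k → (l.map fun n => ρ n - 1).prod = 0 := by
  let A : Subalgebra ℝ R := Algebra.adjoin ℝ (MonoidHom.mrange ρ : Set R)
  have hA : ∀ n, ρ n ∈ A := fun n => Algebra.subset_adjoin ⟨n, rfl⟩
  -- All `ρ n` have the same trace, so `ρ n - 1` is orthogonal to every `ρ m`, hence to the algebra
  -- they span.
  have htr : ∀ n, t (ρ n) = t 1 := fun n => by
    have := ht.nilp _ (hρ n)
    rwa [map_sub, sub_eq_zero] at this
  obtain ⟨k, hk⟩ := (ht.subalgebra A).exists_prod_eq_zero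
  refine ⟨k, fun l hl => ?_⟩
  let f : N → A := fun n => ⟨ρ n - 1, A.sub_mem (hA n) A.one_mem⟩
  have h1 := hk (l.map f) ?_ (by simpa using hl)
  · have h2 := congrArg A.val h1
    rw [map_list_prod, List.map_map, map_zero] at h2
    exact h2
  · intro a ha b
    obtain ⟨n, -, rfl⟩ := List.mem_map.1 ha
    obtain ⟨b, hb⟩ := b
    change t ((ρ n - 1) * b) = 0
    rw [← Subalgebra.mem_toSubmodule, Algebra.adjoin_eq_span, Submonoid.closure_eq] at hb
    induction hb using Submodule.span_induction with
    | mem x hx =>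
      obtain ⟨m, rfl⟩ := hx
      rw [sub_mul, one_mul, ← map_mul, map_sub, htr, htr, sub_self]
    | zero => simp
    | add x y _ _ hx hy => rw [mul_add, map_add, hx, hy, add_zero]
    | smul c x _ hx => rw [mul_smul_comm, map_smul, hx, smul_zero]

/-- A nonzero finite-dimensional unipotent representation has a nonzero fixed vector. -/
theorem exists_fixed_of_unipotent {E N : Type*} [AddCommGroup E] [Module ℝ E]
    [FiniteDimensional ℝ E] [Nontrivial E] [Monoid N] (ρ : Representation ℝ N E)
    (hρ : ∀ n, IsNilpotent (ρ n - 1)) : ∃ e : E, e ≠ 0 ∧ ∀ n, ρ n e = e := by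
  obtain ⟨k, hk⟩ := (isTraceLike_trace (V := E)).exists_prod_sub_one_eq_zero ρ hρ
  have key : ∀ k : ℕ, (∀ l : List N, l.length = k → (l.map fun n => ρ n - 1).prod = 0) →
      ∃ e : E, e ≠ 0 ∧ ∀ n, ρ n e = e := by
    intro k
    induction k with
    | zero =>
      intro h
      have := h [] rfl
      simp at this
    | succ k ih =>
      intro h
      by_cases h' : ∀ l : List N, l.length = k → (l.map fun n => ρ n - 1).prod = 0
      · exact ih h'
      · push Not at h'
        obtain ⟨l, hl, hl0⟩ := h'
        obtain ⟨v, hv⟩ : ∃ v, (l.map fun n => ρ n - 1).prod v ≠ 0 := by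
          by_contra hcon
          push Not at hcon
          exact hl0 (LinearMap.ext hcon)
        -- All products with one more factor vanish, so the range of this nonzero product consists
        -- of fixed vectors.
        refine ⟨_, hv, fun n => ?_⟩
        have := congrArg (fun f => f v) (h (n :: l) (by simp [hl]))
        simp only [List.map_cons, List.prod_cons, Module.End.mul_apply, LinearMap.sub_apply,
          Module.End.one_apply, LinearMap.zero_apply, sub_eq_zero] at this
        exact this
  exact key k hk

/-! ### Fixed points and invariant quadratic forms -/

/-- A uniformly bounded group of linear maps preserving a nonempty compact convex set has a fixed
point in it. -/
theorem exists_fixed_of_isCompact_convex {G H E : Type*} [Group G] [AddCommGroup H] [Module ℝ H]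
    [TopologicalSpace H] [NormedAddCommGroup E] [InnerProductSpace ℝ E]
    (ρ : Representation ℝ G H) (hρ : ∀ g, Continuous (ρ g)) (e : H →ₗ[ℝ] E)
    (he : Continuous e) (hinj : Function.Injective e) (M : ℝ)
    (hM : ∀ g x, ‖e (ρ g x)‖ ^ 2 ≤ M * ‖e x‖ ^ 2)
    (C : Set H) (hC : IsCompact C) (hconv : Convex ℝ C) (hne : C.Nonempty)
    (hinv : ∀ g, ∀ x ∈ C, ρ g x ∈ C) : ∃ x ∈ C, ∀ g, ρ g x = x := by
  -- An invariant, lower semicontinuous function; uniform convexity of the Hilbert norm will show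
  -- that a minimizer on `C` is fixed.
  set F : H → ℝ := fun x => ⨆ g, ‖e (ρ g x)‖ ^ 2
  have hbdd : ∀ x, BddAbove (Set.range fun g => ‖e (ρ g x)‖ ^ 2) := fun x =>
    ⟨M * ‖e x‖ ^ 2, by rintro _ ⟨g, rfl⟩; exact hM g x⟩
  have hF : LowerSemicontinuous F := lowerSemicontinuous_ciSup hbdd fun g =>
    (((he.comp (hρ g)).norm.pow 2)).lowerSemicontinuous
  obtain ⟨x, hxC, hx⟩ := (hF.lowerSemicontinuousOn C).exists_isMinOn hne hC
  refine ⟨x, hxC, fun h => ?_⟩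
  by_contra hcon
  set y := ρ h x
  have hFy : F y = F x := by
    have : F y = ⨆ g, ‖e (ρ (g * h) x)‖ ^ 2 := by
      simp only [F, y, map_mul, Module.End.mul_apply]
    rw [this]
    exact (Equiv.mulRight h).iSup_congr fun g => rfl
  set z := (1 / 2 : ℝ) • x + (1 / 2 : ℝ) • y
  have hzC : z ∈ C := hconv hxC (hinv h x hxC) (by norm_num) (by norm_num) (by norm_num)
  have hpos : 0 < ‖e (y - x)‖ ^ 2 := by
    have : e (y - x) ≠ 0 := fun h0 => hcon (sub_eq_zero.1 (hinj (h0.trans (map_zero e).symm)))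
    positivity
  have hMpos : 0 < M := by
    have := hM 1 (y - x)
    rw [map_one, Module.End.one_apply] at this
    nlinarith
  have hlow : ∀ g w, ‖e w‖ ^ 2 ≤ M * ‖e (ρ g w)‖ ^ 2 := fun g w => by
    have := hM g⁻¹ (ρ g w)
    rwa [← Module.End.mul_apply, ← map_mul, inv_mul_cancel, map_one, Module.End.one_apply] at this
  -- The parallelogram law lowers the value for each g separately. The supremum drops only because
  -- the gain is bounded below uniformly in g, by `hlow`.
  have hFz : F z ≤ F x - ‖e (y - x)‖ ^ 2 / (4 * M) := by
    refine ciSup_le fun g => ?_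
    have h1 := le_ciSup (hbdd x) g
    have h2 := le_ciSup (hbdd y) g
    change _ ≤ F x at h1
    change _ ≤ F y at h2
    rw [hFy] at h2
    have h3 := hlow g (y - x)
    have h4 : ‖e (ρ g z)‖ ^ 2 = (‖e (ρ g x)‖ ^ 2 + ‖e (ρ g y)‖ ^ 2) / 2
        - ‖e (ρ g (y - x))‖ ^ 2 / 4 := by
      have := parallelogram_law_with_norm ℝ (e (ρ g x)) (e (ρ g y))
      have hz : e (ρ g z) = (1 / 2 : ℝ) • (e (ρ g x) + e (ρ g y)) := by
        simp only [z, map_add, map_smul, smul_add]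
      rw [hz, norm_smul, map_sub, map_sub, norm_sub_rev (e (ρ g y))]
      norm_num
      nlinarith
    have h5 : ‖e (y - x)‖ ^ 2 / (4 * M) ≤ ‖e (ρ g (y - x))‖ ^ 2 / 4 := by
      rw [div_le_div_iff₀ (by positivity) (by norm_num)]
      nlinarith
    rw [h4]
    linarith
  have h6 : F x ≤ F z := hx hzC
  have : 0 < ‖e (y - x)‖ ^ 2 / (4 * M) := by positivity
  linarith

open Matrix in
theorem Matrix.dotProduct_mulVec_self_le {m : ℕ} (A : Matrix (Fin m) (Fin m) ℝ) {M : ℝ}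
    (hA : ∀ i j, |A i j| ≤ M) (x : Fin m → ℝ) :
    (A *ᵥ x) ⬝ᵥ (A *ᵥ x) ≤ (m * m * M ^ 2) * (x ⬝ᵥ x) := by
  have hx : x ⬝ᵥ x = ∑ j, x j ^ 2 := Finset.sum_congr rfl fun j _ => (sq _).symm
  have h1 : ∀ i, (A *ᵥ x) i * (A *ᵥ x) i ≤ (m * M ^ 2) * (x ⬝ᵥ x) := fun i => by
    rw [← sq, hx]
    refine (Finset.sum_mul_sq_le_sq_mul_sq Finset.univ (fun j => A i j) x).trans ?_
    refine mul_le_mul_of_nonneg_right ?_ (Finset.sum_nonneg fun j _ => sq_nonneg _)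
    calc ∑ j, A i j ^ 2 ≤ ∑ _j : Fin m, M ^ 2 := Finset.sum_le_sum fun j _ =>
          sq_le_sq' (by linarith [neg_abs_le (A i j), hA i j]) (by linarith [le_abs_self (A i j), hA i j])
      _ = m * M ^ 2 := by simp
  calc (A *ᵥ x) ⬝ᵥ (A *ᵥ x) ≤ ∑ _i : Fin m, (m * M ^ 2) * (x ⬝ᵥ x) :=
        Finset.sum_le_sum fun i _ => h1 i
    _ = _ := by simp; ring

open Matrix in
/-- A bounded matrix group preserves a positive definite quadratic form. -/
theorem Matrix.exists_invariant_form {m : ℕ} {G : Type*} [Group G]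
    (r : G →* Matrix (Fin m) (Fin m) ℝ) {M : ℝ} (hM : ∀ g i j, |r g i j| ≤ M) :
    ∃ S : Matrix (Fin m) (Fin m) ℝ, (∀ g, (r g)ᵀ * S * r g = S) ∧
      ∀ x, x ⬝ᵥ x ≤ x ⬝ᵥ (S *ᵥ x) := by
  set K : ℝ := m * m * M ^ 2
  have hK : ∀ g x, (r g *ᵥ x) ⬝ᵥ (r g *ᵥ x) ≤ K * (x ⬝ᵥ x) := fun g x =>
    Matrix.dotProduct_mulVec_self_le (r g) (hM g) x
  have hK' : ∀ g x, x ⬝ᵥ x ≤ K * ((r g *ᵥ x) ⬝ᵥ (r g *ᵥ x)) := fun g x => by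
    have := hK g⁻¹ (r g *ᵥ x)
    rwa [mulVec_mulVec, ← map_mul, inv_mul_cancel, map_one, one_mulVec] at this
  have hK0 : 0 ≤ K := by positivity
  let ρ : Representation ℝ G (Matrix (Fin m) (Fin m) ℝ) :=
    { toFun := fun g =>
        { toFun := fun S => (r g⁻¹)ᵀ * S * r g⁻¹
          map_add' := fun S T => by rw [mul_add, add_mul]
          map_smul' := fun c S => by simp }
      map_one' := by ext1 S; simp
      map_mul' := fun g h => by
        apply LinearMap.ext
        intro S
        simp [mul_assoc, Matrix.transpose_mul] }
  have hρ : ∀ g S, ρ g S = (r g⁻¹)ᵀ * S * r g⁻¹ := fun g S => rfl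
  have hρx : ∀ g S x, x ⬝ᵥ (ρ g S *ᵥ x) = (r g⁻¹ *ᵥ x) ⬝ᵥ (S *ᵥ (r g⁻¹ *ᵥ x)) := fun g S x => by
    rw [hρ, ← mulVec_mulVec, ← mulVec_mulVec, dotProduct_mulVec, vecMul_transpose]
  let e : Matrix (Fin m) (Fin m) ℝ →ₗ[ℝ] EuclideanSpace ℝ (Fin m × Fin m) :=
    { toFun := fun S => WithLp.toLp 2 fun ij => S ij.1 ij.2
      map_add' := fun S T => rfl
      map_smul' := fun c S => rfl }
  have he : ∀ S, ‖e S‖ ^ 2 = ∑ i, ∑ j, S i j ^ 2 := fun S => by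
    rw [EuclideanSpace.norm_sq_eq, Fintype.sum_prod_type]
    simp only [Real.norm_eq_abs, sq_abs]
    rfl
  -- Imposing the bounds for every g makes the set invariant. The lower bound will give
  -- definiteness, the upper one compactness; the constant K * K leaves room for the multiple `K •
  -- 1` of the identity.
  let C : Set (Matrix (Fin m) (Fin m) ℝ) := {S | Sᵀ = S ∧ ∀ g x,
    (r g *ᵥ x) ⬝ᵥ (r g *ᵥ x) ≤ x ⬝ᵥ (S *ᵥ x) ∧
    x ⬝ᵥ (S *ᵥ x) ≤ K * K * ((r g *ᵥ x) ⬝ᵥ (r g *ᵥ x))}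
  have hquad : ∀ x : Fin m → ℝ, Continuous fun S : Matrix (Fin m) (Fin m) ℝ => x ⬝ᵥ (S *ᵥ x) :=
    fun x => by fun_prop
  have hCclosed : IsClosed C := by
    have : C = {S | Sᵀ = S} ∩ ⋂ g, ⋂ x, ({S | (r g *ᵥ x) ⬝ᵥ (r g *ᵥ x) ≤ x ⬝ᵥ (S *ᵥ x)} ∩
        {S | x ⬝ᵥ (S *ᵥ x) ≤ K * K * ((r g *ᵥ x) ⬝ᵥ (r g *ᵥ x))}) := by
      ext S; simp [C]
    rw [this]
    exact (isClosed_eq (by fun_prop) continuous_id).inter <| isClosed_iInter fun g =>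
      isClosed_iInter fun x => (isClosed_le continuous_const (hquad x)).inter
        (isClosed_le (hquad x) continuous_const)
  have hCbdd : ∃ B : ℝ, ∀ S ∈ C, ∀ i j, S i j ∈ Set.Icc (-B) B := by
    -- Polarization: evaluate the form at e_i, e_j and e_i ± e_j, whose squared lengths are at most
    -- 4.
    refine ⟨K * K * 4, fun S hS i j => ?_⟩
    have hq : ∀ x, 0 ≤ x ⬝ᵥ (S *ᵥ x) ∧ x ⬝ᵥ (S *ᵥ x) ≤ K * K * (x ⬝ᵥ x) := fun x => by
      have := hS.2 1 x
      rw [map_one, one_mulVec] at this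
      refine ⟨le_trans ?_ this.1, this.2⟩
      exact Finset.sum_nonneg fun i _ => mul_self_nonneg _
    have hsym : S j i = S i j := congrFun (congrFun hS.1 i) j
    have h1 := hq (Pi.single i 1)
    have h2 := hq (Pi.single j 1)
    have h3 := hq (Pi.single i 1 + Pi.single j 1)
    have h4 := hq (Pi.single i 1 - Pi.single j 1)
    have hd : ∀ a b : Fin m, (Pi.single a 1 : Fin m → ℝ) ⬝ᵥ (S *ᵥ Pi.single b 1) = S a b :=
      fun a b => by simp
    simp only [mulVec_add, mulVec_sub, dotProduct_add, add_dotProduct, dotProduct_sub,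
      sub_dotProduct, hd, hsym] at h1 h2 h3 h4
    have h5 : ∀ a b : Fin m, (Pi.single a 1 : Fin m → ℝ) ⬝ᵥ Pi.single b 1 ≤ 1 ∧
        0 ≤ (Pi.single a 1 : Fin m → ℝ) ⬝ᵥ Pi.single b 1 := fun a b => by
      by_cases hab : a = b
      · subst hab; simp
      · simp [hab]
    have h6 : (Pi.single i 1 : Fin m → ℝ) ⬝ᵥ Pi.single i 1 = 1 := by simp
    have h7 : (Pi.single j 1 : Fin m → ℝ) ⬝ᵥ Pi.single j 1 = 1 := by simp
    have h8 := h5 i j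
    have h9 := h5 j i
    rw [h6, h7] at h3 h4
    rw [h6] at h1
    rw [h7] at h2
    have hKK : 0 ≤ K * K := by positivity
    constructor <;> nlinarith
  have hCcomp : IsCompact C := by
    obtain ⟨B, hB⟩ := hCbdd
    have : IsCompact (Set.pi Set.univ fun _ : Fin m => Set.pi Set.univ fun _ : Fin m =>
      Set.Icc (-B) B) := isCompact_univ_pi fun _ => isCompact_univ_pi fun _ => isCompact_Icc
    exact this.of_isClosed_subset hCclosed fun S hS i _ j _ => hB S hS i j
  have hCconv : Convex ℝ C := by
    intro S hS T hT a b ha hb hab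
    refine ⟨by rw [transpose_add, transpose_smul, transpose_smul, hS.1, hT.1], fun g x => ?_⟩
    rw [add_mulVec, smul_mulVec, smul_mulVec, dotProduct_add, dotProduct_smul, dotProduct_smul,
      smul_eq_mul, smul_eq_mul]
    have h1 := hS.2 g x
    have h2 := hT.2 g x
    obtain rfl : b = 1 - a := by linarith
    constructor <;> nlinarith
  have hCne : C.Nonempty := by
    refine ⟨K • 1, by simp, fun g x => ?_⟩
    rw [smul_mulVec, one_mulVec, dotProduct_smul, smul_eq_mul]
    refine ⟨hK g x, ?_⟩
    rw [mul_assoc K K]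
    exact mul_le_mul_of_nonneg_left (hK' g x) hK0
  have hCinv : ∀ g, ∀ S ∈ C, ρ g S ∈ C := by
    intro g S hS
    refine ⟨?_, fun h x => ?_⟩
    · rw [hρ, transpose_mul, transpose_mul, hS.1, transpose_transpose, mul_assoc]
    · rw [hρx]
      have := hS.2 (h * g) (r g⁻¹ *ᵥ x)
      rwa [mulVec_mulVec, ← map_mul, mul_inv_cancel_right] at this
  obtain ⟨S, hSC, hS⟩ := exists_fixed_of_isCompact_convex ρ (fun g => by
      change Continuous fun S : Matrix (Fin m) (Fin m) ℝ => (r g⁻¹)ᵀ * S * r g⁻¹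
      fun_prop) e (by
      change Continuous fun S : Matrix (Fin m) (Fin m) ℝ =>
        WithLp.toLp 2 fun ij : Fin m × Fin m => S ij.1 ij.2
      refine (PiLp.continuous_toLp 2 _).comp ?_
      fun_prop) (fun S T h => by
      ext i j
      exact congrFun (congrArg WithLp.ofLp h) (i, j)) (K * K) (fun g S => by
      rw [he, he, hρ]
      -- Left multiplication acts column by column and costs a factor K. Transposing handles the
      -- right multiplication, whence K * K.
      have hcol : ∀ (A T : Matrix (Fin m) (Fin m) ℝ), (∀ i j, |A i j| ≤ M) →
          ∑ i, ∑ j, (A * T) i j ^ 2 ≤ K * ∑ i, ∑ j, T i j ^ 2 := by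
        intro A T hA
        rw [Finset.sum_comm, Finset.sum_comm (f := fun i j => T i j ^ 2), Finset.mul_sum]
        refine Finset.sum_le_sum fun j _ => ?_
        have := Matrix.dotProduct_mulVec_self_le A hA (fun k => T k j)
        rw [Finset.sum_congr rfl fun i _ => sq ((A * T) i j),
          Finset.sum_congr rfl fun i _ => sq (T i j)]
        exact this
      have hT : ∀ T : Matrix (Fin m) (Fin m) ℝ, ∑ i, ∑ j, Tᵀ i j ^ 2 = ∑ i, ∑ j, T i j ^ 2 :=
        fun T => Finset.sum_comm
      rw [mul_assoc, mul_assoc]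
      refine (hcol _ _ fun i j => hM g⁻¹ j i).trans (mul_le_mul_of_nonneg_left ?_ hK0)
      rw [← hT, transpose_mul]
      refine (hcol _ _ fun i j => hM g⁻¹ j i).trans ?_
      rw [hT]) C hCcomp hCconv hCne hCinv
  refine ⟨S, fun g => ?_, fun x => ?_⟩
  · have := hS g⁻¹
    rwa [hρ, inv_inv] at this
  · have := (hSC.2 1 x).1
    rwa [map_one, one_mulVec] at this

/-! ### Polynomial functions on matrices and the Zariski closure -/

/-- The algebra of polynomial functions on the space of `n × n` real matrices. -/
def polyFun (n : ℕ) : Subalgebra ℝ (Matrix (Fin n) (Fin n) ℝ → ℝ) :=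
  Algebra.adjoin ℝ (Set.range fun (ij : Fin n × Fin n) (x : Matrix (Fin n) (Fin n) ℝ) =>
    x ij.1 ij.2)

section polyFun

variable {n : ℕ}

theorem coord_mem_polyFun (i j : Fin n) :
    (fun x : Matrix (Fin n) (Fin n) ℝ => x i j) ∈ polyFun n :=
  Algebra.subset_adjoin ⟨(i, j), rfl⟩

theorem const_mem_polyFun (c : ℝ) : (fun _ : Matrix (Fin n) (Fin n) ℝ => c) ∈ polyFun n :=
  (polyFun n).algebraMap_mem c

theorem linear_mem_polyFun (f : Matrix (Fin n) (Fin n) ℝ →ₗ[ℝ] ℝ) :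
    (fun x => f x) ∈ polyFun n := by
  have : (fun x => f x) = ∑ i, ∑ j, f (Matrix.single i j 1) •
      fun x : Matrix (Fin n) (Fin n) ℝ => x i j := by
    ext x
    conv_lhs => rw [Matrix.matrix_eq_sum_single x]
    simp only [map_sum, Finset.sum_apply, Pi.smul_apply, smul_eq_mul]
    refine Finset.sum_congr rfl fun i _ => Finset.sum_congr rfl fun j _ => ?_
    rw [← mul_one (x i j), ← smul_eq_mul (x i j) 1, ← Matrix.smul_single, map_smul]
    simp [mul_comm]
  rw [this]
  exact Subalgebra.sum_mem _ fun i _ => Subalgebra.sum_mem _ fun j _ =>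
    Subalgebra.smul_mem _ (coord_mem_polyFun i j) _

theorem exists_mvPolynomial_of_mem_polyFun {f : Matrix (Fin n) (Fin n) ℝ → ℝ}
    (hf : f ∈ polyFun n) :
    ∃ p : MvPolynomial (Fin n × Fin n) ℝ, ∀ x, f x = MvPolynomial.aeval (fun ij => x ij.1 ij.2) p := by
  induction hf using Algebra.adjoin_induction with
  | mem x hx =>
    obtain ⟨ij, rfl⟩ := hx
    exact ⟨MvPolynomial.X ij, fun x => by simp⟩
  | algebraMap r => exact ⟨MvPolynomial.C r, fun x => by simp⟩
  | add f g _ _ hf hg =>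
    obtain ⟨p, hp⟩ := hf
    obtain ⟨q, hq⟩ := hg
    exact ⟨p + q, fun x => by rw [map_add, Pi.add_apply, hp, hq]⟩
  | mul f g _ _ hf hg =>
    obtain ⟨p, hp⟩ := hf
    obtain ⟨q, hq⟩ := hg
    exact ⟨p * q, fun x => by rw [map_mul, Pi.mul_apply, hp, hq]⟩

theorem aeval_mem_polyFun (p : MvPolynomial (Fin n × Fin n) ℝ) :
    (fun x : Matrix (Fin n) (Fin n) ℝ => MvPolynomial.aeval (fun ij => x ij.1 ij.2) p)
      ∈ polyFun n := by
  induction p using MvPolynomial.induction_on with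
  | C c => simpa using const_mem_polyFun c
  | add p q hp hq => simp only [map_add]; exact Subalgebra.add_mem _ hp hq
  | mul_X p ij hp =>
    simp only [map_mul, MvPolynomial.aeval_X]
    exact Subalgebra.mul_mem _ hp (coord_mem_polyFun ij.1 ij.2)

theorem continuous_of_mem_polyFun {f : Matrix (Fin n) (Fin n) ℝ → ℝ} (hf : f ∈ polyFun n) :
    Continuous f := by
  induction hf using Algebra.adjoin_induction with
  | mem x hx =>
    obtain ⟨ij, rfl⟩ := hx
    fun_prop
  | algebraMap r => exact continuous_const
  | add f g _ _ hf hg => exact hf.add hg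
  | mul f g _ _ hf hg => exact hf.mul hg

/-- Polynomial functions restrict to polynomials on polynomial curves. -/
theorem exists_polynomial_of_mem_polyFun {f : Matrix (Fin n) (Fin n) ℝ → ℝ} (hf : f ∈ polyFun n)
    (γ : ℝ → Matrix (Fin n) (Fin n) ℝ)
    (hγ : ∀ i j, ∃ p : Polynomial ℝ, ∀ t, γ t i j = p.eval t) :
    ∃ p : Polynomial ℝ, ∀ t, f (γ t) = p.eval t := by
  induction hf using Algebra.adjoin_induction with
  | mem x hx =>
    obtain ⟨ij, rfl⟩ := hx
    exact hγ ij.1 ij.2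
  | algebraMap r => exact ⟨Polynomial.C r, fun t => by simp⟩
  | add f g _ _ hf hg =>
    obtain ⟨p, hp⟩ := hf
    obtain ⟨q, hq⟩ := hg
    exact ⟨p + q, fun x => by rw [Polynomial.eval_add, Pi.add_apply, hp, hq]⟩
  | mul f g _ _ hf hg =>
    obtain ⟨p, hp⟩ := hf
    obtain ⟨q, hq⟩ := hg
    exact ⟨p * q, fun x => by rw [Polynomial.eval_mul, Pi.mul_apply, hp, hq]⟩

theorem mem_zariskiClosureSet_iff_polyFun {S : Set (GL (Fin n) ℝ)} {g : GL (Fin n) ℝ} :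
    g ∈ zariskiClosureSet S ↔
      ∀ f ∈ polyFun n, (∀ s ∈ S, f s.val = 0) → f g.val = 0 := by
  rw [mem_zariskiClosureSet]
  constructor
  · intro h f hf hS
    obtain ⟨p, hp⟩ := exists_mvPolynomial_of_mem_polyFun hf
    rw [hp]
    exact h p fun s hs => by rw [← hS s hs, hp]; rfl
  · intro h p hS
    exact h _ (aeval_mem_polyFun p) hS

theorem subset_zariskiClosureSet (S : Set (GL (Fin n) ℝ)) : S ⊆ zariskiClosureSet S :=
  fun _ hs => mem_zariskiClosureSet_iff_polyFun.2 fun _ _ h => h _ hs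

theorem isClosed_zariskiClosureSet (S : Set (GL (Fin n) ℝ)) : IsClosed (zariskiClosureSet S) := by
  have : zariskiClosureSet S = ⋂ f ∈ {f | f ∈ polyFun n ∧ ∀ s ∈ S, f s.val = 0},
      {g : GL (Fin n) ℝ | f g.val = 0} := by
    ext g
    simp [mem_zariskiClosureSet_iff_polyFun]
  rw [this]
  exact isClosed_biInter fun f hf => isClosed_eq
    ((continuous_of_mem_polyFun hf.1).comp Units.continuous_val) continuous_const

theorem le_zariskiClosure (Γ : Subgroup (GL (Fin n) ℝ)) : Γ ≤ zariskiClosure Γ :=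
  subset_zariskiClosureSet _

theorem eq_zero_of_mem_zariskiClosure {Γ : Subgroup (GL (Fin n) ℝ)} {g : GL (Fin n) ℝ}
    (hg : g ∈ zariskiClosure Γ) {f : Matrix (Fin n) (Fin n) ℝ → ℝ} (hf : f ∈ polyFun n)
    (h : ∀ γ ∈ Γ, f γ.val = 0) : f g.val = 0 :=
  mem_zariskiClosureSet_iff_polyFun.1 hg f hf h

end polyFun

/-! ### The algebra spanned by the group and its trace radical -/

section envelope

variable {n : ℕ}

/-- The real algebra of matrices generated by a subgroup of `GL n ℝ`. -/
def envelope (Γ : Subgroup (GL (Fin n) ℝ)) : Subalgebra ℝ (Matrix (Fin n) (Fin n) ℝ) :=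
  Algebra.adjoin ℝ (MonoidHom.mrange ((Units.coeHom _).comp Γ.subtype) :
    Set (Matrix (Fin n) (Fin n) ℝ))

theorem envelope_toSubmodule (Γ : Subgroup (GL (Fin n) ℝ)) :
    Subalgebra.toSubmodule (envelope Γ) =
      Submodule.span ℝ ((fun g : GL (Fin n) ℝ => g.val) '' (Γ : Set (GL (Fin n) ℝ))) := by
  rw [envelope, Algebra.adjoin_eq_span, Submonoid.closure_eq]
  congr 1
  ext x
  simp

theorem envelope_induction {Γ : Subgroup (GL (Fin n) ℝ)}
    {p : Matrix (Fin n) (Fin n) ℝ → Prop} (mem : ∀ γ ∈ Γ, p γ.val) (zero : p 0)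
    (add : ∀ x y, p x → p y → p (x + y)) (smul : ∀ (c : ℝ) x, p x → p (c • x))
    {x : Matrix (Fin n) (Fin n) ℝ} (hx : x ∈ envelope Γ) : p x := by
  rw [← Subalgebra.mem_toSubmodule, envelope_toSubmodule] at hx
  induction hx using Submodule.span_induction with
  | mem x hx => obtain ⟨γ, hγ, rfl⟩ := hx; exact mem γ hγ
  | zero => exact zero
  | add x y _ _ hx hy => exact add x y hx hy
  | smul c x _ hx => exact smul c x hx

/-- A linear subspace is cut out by linear functionals, and these are polynomials. -/
theorem mem_envelope_of_mem_zariskiClosure {Γ : Subgroup (GL (Fin n) ℝ)} {g : GL (Fin n) ℝ}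
    (hg : g ∈ zariskiClosure Γ) : g.val ∈ envelope Γ := by
  rw [← Subalgebra.mem_toSubmodule]
  by_contra hcon
  obtain ⟨f, hf0, hf⟩ := Submodule.exists_le_ker_of_notMem hcon
  refine hf0 (eq_zero_of_mem_zariskiClosure hg (linear_mem_polyFun f) fun γ hγ => ?_)
  refine hf ?_
  rw [envelope_toSubmodule]
  exact Submodule.subset_span ⟨γ, hγ, rfl⟩

/-- The radical of the trace form on the algebra generated by a linear group. -/
def traceRadical (Γ : Subgroup (GL (Fin n) ℝ)) : Submodule ℝ (Matrix (Fin n) (Fin n) ℝ) where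
  carrier := {a | a ∈ envelope Γ ∧ ∀ b ∈ envelope Γ, (a * b).trace = 0}
  add_mem' ha hb := ⟨add_mem ha.1 hb.1, fun c hc => by
    rw [add_mul, Matrix.trace_add, ha.2 c hc, hb.2 c hc, add_zero]⟩
  zero_mem' := ⟨zero_mem _, fun c _ => by simp⟩
  smul_mem' r a ha := ⟨Subalgebra.smul_mem _ ha.1 r, fun c hc => by
    rw [smul_mul_assoc, Matrix.trace_smul, ha.2 c hc, smul_zero]⟩

variable {Γ : Subgroup (GL (Fin n) ℝ)}

theorem traceRadical_mul_mem {a b : Matrix (Fin n) (Fin n) ℝ} (ha : a ∈ traceRadical Γ)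
    (hb : b ∈ envelope Γ) : a * b ∈ traceRadical Γ :=
  ⟨mul_mem ha.1 hb, fun c hc => by rw [mul_assoc]; exact ha.2 _ (mul_mem hb hc)⟩

theorem mul_traceRadical_mem {a b : Matrix (Fin n) (Fin n) ℝ} (ha : a ∈ traceRadical Γ)
    (hb : b ∈ envelope Γ) : b * a ∈ traceRadical Γ :=
  ⟨mul_mem hb ha.1, fun c hc => by
    rw [mul_assoc, Matrix.trace_mul_comm, mul_assoc]; exact ha.2 _ (mul_mem hc hb)⟩

/-- A matrix of the generated algebra lies in the radical as soon as it is orthogonal to the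
group. -/
theorem mem_traceRadical_of_forall {a : Matrix (Fin n) (Fin n) ℝ} (ha : a ∈ envelope Γ)
    (h : ∀ γ ∈ Γ, (a * γ.val).trace = 0) : a ∈ traceRadical Γ := by
  refine ⟨ha, fun b hb => ?_⟩
  refine envelope_induction (p := fun b => (a * b).trace = 0) h (by simp) ?_ ?_ hb
  · intro x y hx hy
    rw [mul_add, Matrix.trace_add, hx, hy, add_zero]
  · intro c x hx
    rw [mul_smul_comm, Matrix.trace_smul, hx, smul_zero]

/-- The radical of the trace form is nilpotent. -/
theorem traceRadical_exists_prod_eq_zero (Γ : Subgroup (GL (Fin n) ℝ)) :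
    ∃ k : ℕ, ∀ l : List (Matrix (Fin n) (Fin n) ℝ), (∀ a ∈ l, a ∈ traceRadical Γ) →
      l.length = k → l.prod = 0 := by
  obtain ⟨k, hk⟩ := (isTraceLike_matrix_trace.subalgebra (envelope Γ)).exists_prod_eq_zero
  refine ⟨k, fun l hl hlk => ?_⟩
  have hl' : ∀ a ∈ l, a ∈ envelope Γ := fun a ha => (hl a ha).1
  lift l to List (envelope Γ) using hl'
  have := hk l (fun a ha b => (hl a (List.mem_map.2 ⟨a, ha, rfl⟩)).2 b b.2) (by simpa using hlk)
  have h2 := congrArg (envelope Γ).val this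
  rw [map_list_prod, map_zero] at h2
  exact h2

theorem isNilpotent_of_mem_traceRadical {a : Matrix (Fin n) (Fin n) ℝ}
    (ha : a ∈ traceRadical Γ) : IsNilpotent a := by
  obtain ⟨k, hk⟩ := traceRadical_exists_prod_eq_zero Γ
  refine ⟨k, ?_⟩
  have := hk (List.replicate k a) (fun b hb => by rwa [List.eq_of_mem_replicate hb]) (by simp)
  simpa using this

/-- The group is bounded modulo the radical of the trace form. -/
theorem exists_bounded_projection
    (hΓ : Bornology.IsBounded ((fun γ : GL (Fin n) ℝ => γ.val.trace) '' (Γ : Set (GL (Fin n) ℝ)))) :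
    ∃ c : Matrix (Fin n) (Fin n) ℝ →ₗ[ℝ] Matrix (Fin n) (Fin n) ℝ,
      (∀ a ∈ envelope Γ, a - c a ∈ traceRadical Γ) ∧
      ∃ M : ℝ, ∀ g ∈ zariskiClosure Γ, ∀ i j, |c g.val i j| ≤ M := by
  obtain ⟨M₀, hM₀⟩ := hΓ.exists_norm_le
  have hM₀ : ∀ γ ∈ Γ, |γ.val.trace| ≤ M₀ := fun γ hγ => hM₀ _ ⟨γ, hγ, rfl⟩
  have htr : ∀ a ∈ envelope Γ, ∃ M, ∀ γ ∈ Γ, |(γ.val * a).trace| ≤ M := by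
    intro a ha
    refine envelope_induction (p := fun a => ∃ M, ∀ γ ∈ Γ, |(γ.val * a).trace| ≤ M) ?_ ?_ ?_ ?_ ha
    · intro δ hδ
      exact ⟨M₀, fun γ hγ => hM₀ (γ * δ) (Γ.mul_mem hγ hδ)⟩
    · exact ⟨0, fun γ _ => by simp⟩
    · rintro x y ⟨M, hM⟩ ⟨M', hM'⟩
      refine ⟨M + M', fun γ hγ => ?_⟩
      rw [mul_add, Matrix.trace_add]
      exact (abs_add_le _ _).trans (add_le_add (hM γ hγ) (hM' γ hγ))
    · rintro c x ⟨M, hM⟩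
      refine ⟨|c| * M, fun γ hγ => ?_⟩
      rw [mul_smul_comm, Matrix.trace_smul, smul_eq_mul, abs_mul]
      exact mul_le_mul_of_nonneg_left (hM γ hγ) (abs_nonneg c)
  let A := envelope Γ
  let J : Submodule ℝ A := (traceRadical Γ).comap A.val.toLinearMap
  let b := Module.finBasis ℝ (A ⧸ J)
  set m := Module.finrank ℝ (A ⧸ J)
  let T : A →ₗ[ℝ] (Fin m → ℝ) := b.equivFun.toLinearMap ∘ₗ J.mkQ
  have hTker : ∀ a : A, T a = 0 ↔ a.val ∈ traceRadical Γ := fun a => by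
    simp only [T, LinearMap.comp_apply, LinearEquiv.coe_coe, LinearEquiv.map_eq_zero_iff,
      Submodule.mkQ_apply, Submodule.Quotient.mk_eq_zero]
    rfl
  have hTsurj : Function.Surjective T := b.equivFun.surjective.comp J.mkQ_surjective
  let ι : Γ →* A :=
    { toFun := fun γ => ⟨γ.val.val, mem_envelope_of_mem_zariskiClosure (le_zariskiClosure Γ γ.2)⟩
      map_one' := rfl
      map_mul' := fun _ _ => rfl }
  have hJ : ∀ x : A, J ≤ J.comap (LinearMap.mulLeft ℝ x) := fun x a ha =>
    mul_traceRadical_mem ha x.2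
  let ρ : Γ →* Module.End ℝ (A ⧸ J) :=
    { toFun := fun γ => J.mapQ J (LinearMap.mulLeft ℝ (ι γ)) (hJ _)
      map_one' := by
        ext a
        simp
      map_mul' := fun γ δ => by
        ext a
        simp }
  let r : Γ →* Matrix (Fin m) (Fin m) ℝ :=
    (LinearMap.toMatrixAlgEquiv b : _ →* Matrix (Fin m) (Fin m) ℝ).comp ρ
  have hr : ∀ γ a, T (ι γ * a) = (r γ).mulVec (T a) := fun γ a => by
    have h1 : (r γ).mulVec (b.repr (J.mkQ a)) = b.repr (ρ γ (J.mkQ a)) :=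
      LinearMap.toMatrix_mulVec_repr b b (ρ γ) (J.mkQ a)
    exact h1.symm
  have hbound : ∃ M, ∀ γ i j, |r γ i j| ≤ M := by
    have h1 : ∀ i j, ∃ M, ∀ γ, |r γ i j| ≤ M := by
      intro i j
      obtain ⟨a, ha⟩ := hTsurj (Pi.single j 1)
      have h2 : ∀ γ, r γ i j = T (ι γ * a) i := fun γ => by rw [hr, ha]; simp
      let Φ : A →ₗ[ℝ] Module.Dual ℝ A :=
        (LinearMap.mul ℝ A).flip.compr₂ (Matrix.traceLinearMap (Fin n) ℝ ℝ ∘ₗ A.val.toLinearMap)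
      have hΦ : ∀ x y, Φ x y = (y.val * x.val).trace := fun x y => rfl
      -- In finite dimension the functionals tr(· x) fill the annihilator of their common kernel,
      -- which is `J`. So a matrix coefficient of `r γ` is a trace tr(γ a x), and `htr` bounds it.
      have h3 : LinearMap.proj i ∘ₗ T ∈ LinearMap.range Φ := by
        rw [← Subspace.dualCoannihilator_dualAnnihilator_eq (W := LinearMap.range Φ),
          Submodule.mem_dualAnnihilator]
        intro w hw
        rw [Submodule.mem_dualCoannihilator] at hw
        have : T w = 0 := by
          rw [hTker]
          exact ⟨w.2, fun x hx => hw (Φ ⟨x, hx⟩) ⟨_, rfl⟩⟩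
        simp [this]
      obtain ⟨x, hx⟩ := h3
      obtain ⟨M, hM⟩ := htr (a * x : A) (a * x : A).2
      refine ⟨M, fun γ => ?_⟩
      rw [h2]
      have h4 := LinearMap.congr_fun hx (ι γ * a)
      change _ = T (ι γ * a) i at h4
      rw [← h4, hΦ]
      have := hM γ γ.2
      rw [show ((a * x : A) : Matrix (Fin n) (Fin n) ℝ) = a.val * x.val from rfl, ← mul_assoc] at this
      exact this
    choose M hM using h1
    refine ⟨∑ i, ∑ j, |M i j|, fun γ i j => (hM i j γ).trans ((le_abs_self _).trans ?_)⟩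
    exact (Finset.single_le_sum (f := fun j => |M i j|) (fun j _ => abs_nonneg _)
      (Finset.mem_univ j)).trans (Finset.single_le_sum (f := fun i => ∑ j, |M i j|)
      (fun i _ => Finset.sum_nonneg fun j _ => abs_nonneg _) (Finset.mem_univ i))
  obtain ⟨M, hM⟩ := hbound
  obtain ⟨S, hS, hSpos⟩ := Matrix.exists_invariant_form r hM
  obtain ⟨pr, hpr⟩ := LinearMap.exists_leftInverse_of_injective A.val.toLinearMap
    (LinearMap.ker_eq_bot.2 Subtype.val_injective)
  have hpr : ∀ a : A, pr a.val = a := fun a => LinearMap.congr_fun hpr a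
  obtain ⟨σ, hσ⟩ := LinearMap.exists_rightInverse_of_surjective T (LinearMap.range_eq_top.2 hTsurj)
  have hσ : ∀ v, T (σ v) = v := fun v => LinearMap.congr_fun hσ v
  refine ⟨A.val.toLinearMap ∘ₗ σ ∘ₗ T ∘ₗ pr, fun a ha => ?_, ?_⟩
  · have h1 : T (⟨a, ha⟩ - σ (T (pr a))) = 0 := by
      rw [map_sub, hσ, hpr ⟨a, ha⟩, sub_self]
    exact (hTker _).1 h1
  · set Q : (Fin m → ℝ) → ℝ := fun v => v ⬝ᵥ S.mulVec v
    have hQΓ : ∀ γ ∈ Γ, Q (T (pr γ.val)) = Q (T 1) := fun γ hγ => by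
      have h1 : pr γ.val = ι ⟨γ, hγ⟩ * 1 := by rw [mul_one]; exact hpr (ι ⟨γ, hγ⟩)
      simp only [Q]
      rw [h1, hr]
      conv_rhs => rw [← hS ⟨γ, hγ⟩]
      rw [← Matrix.mulVec_mulVec, ← Matrix.mulVec_mulVec, Matrix.dotProduct_mulVec (T 1),
        Matrix.vecMul_transpose]
    -- Bounds do not pass to a Zariski closure but polynomial equations do, so boundedness is
    -- encoded in the level set of an invariant definite form.
    have hQpoly : (fun x => Q (T (pr x)) - Q (T 1)) ∈ polyFun n := by
      refine Subalgebra.sub_mem _ ?_ (const_mem_polyFun _)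
      have h1 : ∀ i, (fun x => T (pr x) i) ∈ polyFun n := fun i =>
        linear_mem_polyFun (LinearMap.proj i ∘ₗ T ∘ₗ pr)
      have h2 : (fun x => Q (T (pr x))) =
          ∑ i, (fun x => T (pr x) i) * ∑ j, S i j • fun x => T (pr x) j := by
        ext x
        simp [Q, dotProduct, Matrix.mulVec]
      rw [h2]
      exact Subalgebra.sum_mem _ fun i _ => Subalgebra.mul_mem _ (h1 i)
        (Subalgebra.sum_mem _ fun j _ => Subalgebra.smul_mem _ (h1 j) _)
    have hQG : ∀ g ∈ zariskiClosure Γ, Q (T (pr g.val)) = Q (T 1) := fun g hg =>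
      sub_eq_zero.1 (eq_zero_of_mem_zariskiClosure hg hQpoly fun γ hγ => sub_eq_zero.2 (hQΓ γ hγ))
    -- From t² ≤ q follows |t| ≤ q + 1, which avoids square roots.
    set B := Q (T 1) + 1
    have hTG : ∀ g ∈ zariskiClosure Γ, ∀ k, |T (pr g.val) k| ≤ B := fun g hg k => by
      have h1 := hSpos (T (pr g.val))
      change _ ≤ Q _ at h1
      rw [hQG g hg] at h1
      have h2 : T (pr g.val) k * T (pr g.val) k ≤ T (pr g.val) ⬝ᵥ T (pr g.val) :=
        Finset.single_le_sum (f := fun k => T (pr g.val) k * T (pr g.val) k)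
          (fun i _ => mul_self_nonneg _) (Finset.mem_univ k)
      rw [abs_le]
      constructor <;> nlinarith [sq_nonneg (T (pr g.val) k - 1), sq_nonneg (T (pr g.val) k + 1)]
    set s : Fin m → Matrix (Fin n) (Fin n) ℝ := fun k => (σ (Pi.single k 1)).val
    refine ⟨∑ i, ∑ j, ∑ k, B * |s k i j|, fun g hg i j => ?_⟩
    have h1 : ∀ v : Fin m → ℝ, (σ v).val i j = ∑ k, v k * s k i j := fun v => by
      have h2 : v = ∑ k, v k • Pi.single k (1 : ℝ) := by
        ext i; simp [Finset.sum_apply, Pi.single_apply]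
      conv_lhs => rw [h2]
      rw [map_sum]
      simp [s, Matrix.sum_apply]
    have h3 : |(σ (T (pr g.val))).val i j| ≤ ∑ k, B * |s k i j| := by
      rw [h1]
      refine (Finset.abs_sum_le_sum_abs _ _).trans (Finset.sum_le_sum fun k _ => ?_)
      rw [abs_mul]
      exact mul_le_mul_of_nonneg_right (hTG g hg k) (abs_nonneg _)
    have h4 : ∀ i j, 0 ≤ ∑ k, B * |s k i j| := fun i j => Finset.sum_nonneg fun k _ =>
      mul_nonneg ((abs_nonneg _).trans (hTG g hg k)) (abs_nonneg _)
    refine h3.trans ?_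
    exact (Finset.single_le_sum (f := fun j => ∑ k, B * |s k i j|) (fun j _ => h4 i j)
      (Finset.mem_univ j)).trans (Finset.single_le_sum (f := fun i => ∑ j, ∑ k, B * |s k i j|)
      (fun i _ => Finset.sum_nonneg fun j _ => h4 i j) (Finset.mem_univ i))

end envelope

/-! ### The unipotent radical as the part of the closure congruent to 1 modulo the trace radical -/

section radicalGroup

variable {n : ℕ} {Γ : Subgroup (GL (Fin n) ℝ)}

/-- The geometric series for the inverse terminates. An argument is needed because `u` need not lie
in the Zariski closure. -/
theorem inv_mem_envelope_of_sub_one_mem {u : GL (Fin n) ℝ} (hu : u.val - 1 ∈ traceRadical Γ) :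
    (u⁻¹).val ∈ envelope Γ := by
  obtain ⟨k, hk⟩ := isNilpotent_of_mem_traceRadical hu
  have h1 := mul_neg_geom_sum (-(u.val - 1)) k
  rw [neg_pow, hk, mul_zero, sub_zero, sub_neg_eq_add, add_sub_cancel] at h1
  have h2 : (u⁻¹).val = ∑ i ∈ Finset.range k, (-(u.val - 1)) ^ i :=
    left_inv_eq_right_inv u.inv_mul h1
  rw [h2]
  exact sum_mem fun i _ => pow_mem (neg_mem hu.1) i

/-- The unipotent group of all matrices congruent to `1` modulo the radical of the trace form. -/
def radicalGroup (Γ : Subgroup (GL (Fin n) ℝ)) : Subgroup (GL (Fin n) ℝ) where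
  carrier := {u | u.val - 1 ∈ traceRadical Γ}
  one_mem' := by simp [zero_mem]
  mul_mem' {u v} hu hv := by
    have : (u * v).val - 1 = (u.val - 1) * (v.val - 1) + (u.val - 1) + (v.val - 1) := by
      rw [Units.val_mul]; noncomm_ring
    change (u * v).val - 1 ∈ traceRadical Γ
    rw [this]
    exact add_mem (add_mem (traceRadical_mul_mem hu hv.1) hu) hv
  inv_mem' {u} hu := by
    have : (u⁻¹).val - 1 = -((u.val - 1) * (u⁻¹).val) := by
      rw [sub_mul, ← Units.val_mul, mul_inv_cancel, Units.val_one, one_mul, neg_sub]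
    change (u⁻¹).val - 1 ∈ traceRadical Γ
    rw [this]
    exact neg_mem (traceRadical_mul_mem hu (inv_mem_envelope_of_sub_one_mem hu))

theorem mem_radicalGroup {u : GL (Fin n) ℝ} :
    u ∈ radicalGroup Γ ↔ u.val - 1 ∈ traceRadical Γ := Iff.rfl

theorem isNilpotent_of_mem_radicalGroup {u : GL (Fin n) ℝ} (hu : u ∈ radicalGroup Γ) :
    IsNilpotent (u.val - 1) :=
  isNilpotent_of_mem_traceRadical hu

/-- Moving all factors g to the right conjugates each h - 1 by a power of g, and normality keeps the
conjugates in `H`. With Kolchin's theorem for `H`, this makes (h - 1) g nilpotent. -/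
theorem exists_pow_eq_prod_of_normal {G : Subgroup (GL (Fin n) ℝ)} {H : Subgroup G}
    (hH : H.Normal) (h : H) (g : G) (k : ℕ) : ∃ l : List H, l.length = k ∧
      ((h.val.val.val - 1) * g.val.val) ^ k =
        (l.map fun u : H => u.val.val.val - 1).prod * (g ^ k).val.val := by
  induction k with
  | zero => exact ⟨[], rfl, by simp⟩
  | succ k ih =>
    obtain ⟨l, hl, hprod⟩ := ih
    refine ⟨l ++ [⟨g ^ k * h * (g ^ k)⁻¹, hH.conj_mem _ h.2 _⟩], by simp [hl], ?_⟩
    have h1 : (g ^ k).val.val * (h.val.val.val - 1) * g.val.val =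
        ((g ^ k * h * (g ^ k)⁻¹ : G).val.val - 1) * (g ^ (k + 1)).val.val := by
      have e1 : (g ^ k * h * (g ^ k)⁻¹ : G) * g ^ (k + 1) = g ^ k * h * g := by
        rw [pow_succ]; group
      have e2 := congrArg (fun x : G => x.val.val) e1
      simp only [Subgroup.coe_mul, Units.val_mul] at e2
      rw [sub_mul, one_mul]
      simp only [Subgroup.coe_mul, Units.val_mul]
      rw [e2, pow_succ, Subgroup.coe_mul, Units.val_mul]
      noncomm_ring
    rw [pow_succ, hprod, List.map_append, List.prod_append, mul_assoc, mul_assoc, ← mul_assoc _ _ g.val.val, h1]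
    simp

/-- If h lies in a normal unipotent subgroup, then (h - 1) γ is nilpotent for each γ in Γ, so h - 1
is orthogonal to Γ. Conversely, the elements congruent to 1 modulo the two-sided ideal J form a
normal subgroup, unipotent because J consists of nilpotents. -/
theorem mem_unipotentRadical_iff {g : zariskiClosure Γ} :
    g ∈ unipotentRadical (zariskiClosure Γ) ↔ g.val ∈ radicalGroup Γ := by
  have hval : ∀ x : zariskiClosure Γ, x.val.val ∈ envelope Γ := fun x =>
    mem_envelope_of_mem_zariskiClosure x.2
  suffices h : unipotentRadical (zariskiClosure Γ) =
      (radicalGroup Γ).subgroupOf (zariskiClosure Γ) by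
    rw [h, Subgroup.mem_subgroupOf]
  refine le_antisymm (sSup_le ?_) (le_sSup ⟨⟨fun u hu g => ?_⟩, fun u hu => ?_⟩)
  · rintro H ⟨hH, hunip⟩ h hh
    obtain ⟨k, hk⟩ := isTraceLike_matrix_trace.exists_prod_sub_one_eq_zero
      ((Units.coeHom (Matrix (Fin n) (Fin n) ℝ)).comp ((zariskiClosure Γ).subtype.comp H.subtype))
      (fun u => hunip u u.2)
    refine mem_traceRadical_of_forall (sub_mem (hval h) (one_mem _)) fun γ hγ => ?_
    refine isTraceLike_matrix_trace.nilp _ ⟨k, ?_⟩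
    obtain ⟨l, hl, hprod⟩ := exists_pow_eq_prod_of_normal hH ⟨h, hh⟩ ⟨γ, le_zariskiClosure Γ hγ⟩ k
    have h1 := hk l hl
    change (l.map fun u : H => u.val.val.val - 1).prod = 0 at h1
    rw [h1, zero_mul] at hprod
    exact hprod
  · rw [Subgroup.mem_subgroupOf, mem_radicalGroup] at hu ⊢
    have : (g * u * g⁻¹ : zariskiClosure Γ).val.val - 1
        = g.val.val * (u.val.val - 1) * (g⁻¹).val.val := by
      have e1 := congrArg (fun x : zariskiClosure Γ => x.val.val) (mul_inv_cancel g)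
      simp only [Subgroup.coe_mul, Units.val_mul, Subgroup.coe_one, Units.val_one] at e1
      simp only [Subgroup.coe_mul, Units.val_mul]
      rw [mul_sub, sub_mul, mul_one, e1]
    rw [this]
    exact traceRadical_mul_mem (mul_traceRadical_mem hu (hval g)) (hval g⁻¹)
  · exact isNilpotent_of_mem_radicalGroup (Subgroup.mem_subgroupOf.1 hu)

theorem isUnipotentSubgroup_unipotentRadical (Γ : Subgroup (GL (Fin n) ℝ)) :
    IsUnipotentSubgroup (unipotentRadical (zariskiClosure Γ)) := fun _ hu =>
  isNilpotent_of_mem_radicalGroup (mem_unipotentRadical_iff.1 hu)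

/-- Inside the closure of Γ, the radical is defined by the affine equations tr((x - 1) b) = 0 with b
in the envelope. -/
theorem isZariskiClosed_unipotentRadical (Γ : Subgroup (GL (Fin n) ℝ)) :
    IsZariskiClosed (((unipotentRadical (zariskiClosure Γ)).map (zariskiClosure Γ).subtype :
      Subgroup (GL (Fin n) ℝ)) : Set (GL (Fin n) ℝ)) := by
  refine Set.Subset.antisymm (fun g hg => ?_) (subset_zariskiClosureSet _)
  rw [mem_zariskiClosureSet_iff_polyFun] at hg
  have hmem : ∀ s ∈ (((unipotentRadical (zariskiClosure Γ)).map (zariskiClosure Γ).subtype :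
      Subgroup (GL (Fin n) ℝ)) : Set (GL (Fin n) ℝ)), s ∈ zariskiClosure Γ ∧
        s ∈ radicalGroup Γ := by
    rintro _ ⟨u, hu, rfl⟩
    exact ⟨u.2, mem_unipotentRadical_iff.1 hu⟩
  have hgG : g ∈ zariskiClosure Γ := mem_zariskiClosureSet_iff_polyFun.2 fun f hf h =>
    hg f hf fun s hs => eq_zero_of_mem_zariskiClosure (hmem s hs).1 hf h
  refine ⟨⟨g, hgG⟩, mem_unipotentRadical_iff.2 ⟨sub_mem (mem_envelope_of_mem_zariskiClosure hgG)
    (one_mem _), fun b hb => ?_⟩, rfl⟩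
  have hpoly : (fun x : Matrix (Fin n) (Fin n) ℝ => ((x - 1) * b).trace) ∈ polyFun n := by
    have : (fun x : Matrix (Fin n) (Fin n) ℝ => ((x - 1) * b).trace) =
        (fun x => (Matrix.traceLinearMap (Fin n) ℝ ℝ ∘ₗ LinearMap.mulRight ℝ b) x) -
          fun _ => b.trace := by
      ext x
      simp [sub_mul]
    rw [this]
    exact Subalgebra.sub_mem _ (linear_mem_polyFun _) (const_mem_polyFun _)
  exact hg _ hpoly fun s hs => (hmem s hs).2.2 b hb

end radicalGroup

/-! ### Orbits of unipotent representations -/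

theorem exists_dual_apply_ne_zero {E : Type*} [AddCommGroup E] [Module ℝ E] {v : E} (hv : v ≠ 0) :
    ∃ f : Module.Dual ℝ E, f v ≠ 0 := by
  by_contra hcon
  push Not at hcon
  exact hv ((Module.forall_dual_apply_eq_zero_iff ℝ v).1 hcon)

/-- A representation of a group `N` with real powers `pow u t` is polynomial along the powers if
its matrix coefficients are polynomials in `t`, which agree with the usual powers at natural
numbers. -/
structure IsPolynomialAlong {N E : Type*} [Group N] [AddCommGroup E] [Module ℝ E]
    (pow : N → ℝ → N) (τ : Representation ℝ N E) : Prop where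
  nat : ∀ u (k : ℕ), pow u k = u ^ k
  poly : ∀ u (f : Module.Dual ℝ E) v, ∃ p : Polynomial ℝ, ∀ t, f (τ (pow u t) v) = p.eval t

namespace IsPolynomialAlong

variable {N : Type*} [Group N] {pow : N → ℝ → N}

theorem quotient {E : Type*} [AddCommGroup E] [Module ℝ E] {τ : Representation ℝ N E}
    (h : IsPolynomialAlong pow τ) (W : Submodule ℝ E) (hW : ∀ g, W ≤ W.comap (τ g)) :
    IsPolynomialAlong pow (τ.quotient W hW) where
  nat := h.nat
  poly u f v := by
    obtain ⟨v, rfl⟩ := W.mkQ_surjective v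
    exact h.poly u (f ∘ₗ W.mkQ) v

/-- The D-th finite difference at 0 of the polynomial t ↦ f(τ(uᵗ) v) is f((τ u - 1)^D v), so it
vanishes once D exceeds the degree. -/
theorem isNilpotent_sub_one {E : Type*} [AddCommGroup E] [Module ℝ E] [FiniteDimensional ℝ E]
    {τ : Representation ℝ N E} (h : IsPolynomialAlong pow τ) (u : N) :
    IsNilpotent (τ u - 1) := by
  rw [Module.End.isNilpotent_iff_of_finite]
  intro v
  have key : ∀ f : Module.Dual ℝ E, ∃ D₀, ∀ D, D₀ < D → f (((τ u - 1) ^ D : Module.End ℝ E) v) = 0 := by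
    intro f
    obtain ⟨p, hp⟩ := h.poly u f v
    refine ⟨p.natDegree, fun D hD => ?_⟩
    have h1 : ∀ D k : ℕ, (fwdDiff 1)^[D] (fun t => p.eval t) (k : ℝ)
        = f (((τ u - 1) ^ D * τ u ^ k : Module.End ℝ E) v) := by
      intro D
      induction D with
      | zero =>
        intro k
        rw [Function.iterate_zero, id, ← hp, h.nat, map_pow, pow_zero, one_mul]
      | succ D ih =>
        intro k
        rw [Function.iterate_succ_apply', fwdDiff]
        have := ih (k + 1)
        push_cast at this
        rw [this, ih, ← map_sub, ← LinearMap.sub_apply, pow_succ (τ u - 1) D, pow_succ' (τ u) k]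
        congr 2
        noncomm_ring
    have h2 := h1 D 0
    rw [pow_zero, mul_one] at h2
    rw [← h2]
    exact congrFun (Polynomial.fwdDiff_iter_eq_zero_of_degree_lt hD) _
  let b := Module.finBasis ℝ E
  choose D₀ hD₀ using fun i => key (b.coord i)
  refine ⟨∑ i, D₀ i + 1, b.ext_elem fun i => ?_⟩
  rw [map_zero, Finsupp.zero_apply, ← Module.Basis.coord_apply]
  exact hD₀ i _ (Nat.lt_succ_of_le (Finset.single_le_sum (f := D₀) (fun _ _ => Nat.zero_le _)
    (Finset.mem_univ i)))

theorem span_fixed_le_comap {E : Type*} [AddCommGroup E] [Module ℝ E]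
    {τ : Representation ℝ N E} {e : E} (he : ∀ n, τ n e = e) (g : N) :
    Submodule.span ℝ {e} ≤ (Submodule.span ℝ {e}).comap (τ g) := by
  rw [Submodule.span_singleton_le_iff_mem, Submodule.mem_comap, he]
  exact Submodule.mem_span_singleton_self e

theorem finrank_quotient_lt {E : Type*} [AddCommGroup E] [Module ℝ E] [FiniteDimensional ℝ E]
    {e : E} (he : e ≠ 0) :
    Module.finrank ℝ (E ⧸ Submodule.span ℝ {e}) < Module.finrank ℝ E := by
  have h1 := Submodule.finrank_quotient_add_finrank (Submodule.span ℝ {e})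
  rw [finrank_span_singleton he] at h1
  omega

/-- In a unipotent representation a nonzero vector is detected by a functional that is constant on
its orbit. -/
theorem exists_invariant_functional {E : Type*} [AddCommGroup E] [Module ℝ E]
    [FiniteDimensional ℝ E] {τ : Representation ℝ N E} (h : IsPolynomialAlong pow τ) {v : E}
    (hv : v ≠ 0) : ∃ f : Module.Dual ℝ E, f v ≠ 0 ∧ ∀ n, f (τ n v) = f v := by
  induction hd : Module.finrank ℝ E using Nat.strong_induction_on generalizing E with
  | _ d ih =>
    have : Nontrivial E := ⟨v, 0, hv⟩
    obtain ⟨e, he0, he⟩ := exists_fixed_of_unipotent τ h.isNilpotent_sub_one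
    by_cases hmem : v ∈ Submodule.span ℝ {e}
    · obtain ⟨c, rfl⟩ := Submodule.mem_span_singleton.1 hmem
      obtain ⟨f, hf⟩ := exists_dual_apply_ne_zero hv
      exact ⟨f, hf, fun n => by rw [map_smul, he]⟩
    · obtain ⟨f, hf0, hf⟩ := ih _ (hd ▸ finrank_quotient_lt he0)
        (h.quotient _ (span_fixed_le_comap he)) (v := Submodule.Quotient.mk v)
        (by rwa [Ne, Submodule.Quotient.mk_eq_zero]) rfl
      exact ⟨f ∘ₗ Submodule.mkQ _, hf0, hf⟩

open scoped Pointwise in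
/-- Orbit maps of unipotent representations are proper modulo the stabilizer. -/
theorem exists_isCompact_mul_stabilizer [TopologicalSpace N] [IsTopologicalGroup N]
    (hpow : ∀ u, Continuous (pow u)) {E : Type*} [AddCommGroup E] [Module ℝ E]
    [FiniteDimensional ℝ E] {τ : Representation ℝ N E} (h : IsPolynomialAlong pow τ)
    (hcont : ∀ (f : Module.Dual ℝ E) v, Continuous fun n => f (τ n v)) (v : E) (C : Set N)
    (hC : ∀ f : Module.Dual ℝ E, ∃ M, ∀ n ∈ C, |f (τ n v)| ≤ M) :
    ∃ K : Set N, IsCompact K ∧ ∀ n ∈ C, ∃ m ∈ K, τ (m⁻¹ * n) v = v := by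
  induction hd : Module.finrank ℝ E using Nat.strong_induction_on generalizing E with
  | _ d ih =>
    rcases subsingleton_or_nontrivial E with hE | hE
    · exact ⟨{1}, isCompact_singleton, fun n _ => ⟨1, rfl, Subsingleton.elim _ _⟩⟩
    obtain ⟨e, he0, he⟩ := exists_fixed_of_unipotent τ h.isNilpotent_sub_one
    obtain ⟨K, hK, hCK⟩ := ih _ (hd ▸ finrank_quotient_lt he0)
      (h.quotient _ (span_fixed_le_comap he)) (fun f w => by
        obtain ⟨w, rfl⟩ := Submodule.mkQ_surjective _ w
        exact hcont (f ∘ₗ Submodule.mkQ _) w) (Submodule.Quotient.mk v)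
      (fun f => hC (f ∘ₗ Submodule.mkQ _)) rfl
    obtain ⟨f, hf⟩ : ∃ f : Module.Dual ℝ E, f e = 1 := by
      obtain ⟨f, hf⟩ := exists_dual_apply_ne_zero he0
      exact ⟨(f e)⁻¹ • f, by simp [hf]⟩
    -- By induction, a compact correction brings the orbit point into the line v + ℝ e; `φ` is the
    -- coordinate that remains.
    set φ : N → ℝ := fun s => f (τ s v - v)
    have hφ : ∀ s, τ s v - v ∈ Submodule.span ℝ {e} → τ s v = v + φ s • e := fun s hs => by
      obtain ⟨c, hc⟩ := Submodule.mem_span_singleton.1 hs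
      have : φ s = c := by
        change f (τ s v - v) = c
        rw [← hc, map_smul, hf, smul_eq_mul, mul_one]
      rw [this, hc]; abel
    have hCK' : ∀ n ∈ C, ∃ m ∈ K, τ (m⁻¹ * n) v - v ∈ Submodule.span ℝ {e} := by
      intro n hn
      obtain ⟨m, hm, hmn⟩ := hCK n hn
      exact ⟨m, hm, (Submodule.Quotient.eq _).1 hmn⟩
    -- Either the stabilizer of v modulo e already fixes v, or some `u` in it moves v along e, and
    -- then the real powers of `u` sweep out the whole line.
    by_cases hall : ∀ s, τ s v - v ∈ Submodule.span ℝ {e} → φ s = 0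
    · refine ⟨K, hK, fun n hn => ?_⟩
      obtain ⟨m, hm, hmn⟩ := hCK' n hn
      exact ⟨m, hm, by rw [hφ _ hmn, hall _ hmn, zero_smul, add_zero]⟩
    push Not at hall
    obtain ⟨u, hu, hφu⟩ := hall
    have hnat : ∀ k : ℕ, τ (u ^ k) v = v + ((k : ℝ) * φ u) • e := by
      intro k
      induction k with
      | zero => simp
      | succ k ihk =>
        rw [pow_succ', map_mul, Module.End.mul_apply, ihk, map_add, map_smul, he, hφ u hu]
        push_cast
        module
    have hreal : ∀ t : ℝ, τ (pow u t) v = v + (t * φ u) • e := by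
      intro t
      rw [← sub_eq_zero, ← Module.forall_dual_apply_eq_zero_iff ℝ]
      intro g
      obtain ⟨p, hp⟩ := h.poly u g v
      have hpq : p = Polynomial.C (g v) + Polynomial.C (φ u * g e) * Polynomial.X := by
        refine Polynomial.eq_of_infinite_eval_eq _ _
          ((Set.infinite_range_of_injective (Nat.cast_injective (R := ℝ))).mono ?_)
        rintro _ ⟨k, rfl⟩
        rw [Set.mem_ofPred_eq, ← hp, h.nat, hnat]
        simp
        ring
      rw [map_sub, hp, hpq]
      simp
      ring
    obtain ⟨M, hM⟩ := hC f
    obtain ⟨M', hM'⟩ := hK.exists_bound_of_continuousOn (hcont f v).continuousOn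
    -- The remaining coordinate is at most M + M' in absolute value, and the power `t` of `u` shifts
    -- it by t φ(u), so exponents in [-R, R] suffice.
    set R := (M + M') / |φ u|
    refine ⟨K * (pow u '' Set.Icc (-R) R), hK.mul (isCompact_Icc.image (hpow u)), fun n hn => ?_⟩
    obtain ⟨m, hm, hmn⟩ := hCK' n hn
    have h1 : τ n v = τ m v + φ (m⁻¹ * n) • e := by
      have : n = m * (m⁻¹ * n) := by group
      conv_lhs => rw [this]
      rw [map_mul, Module.End.mul_apply, hφ _ hmn, map_add, map_smul, he]
    have h2 : |φ (m⁻¹ * n)| ≤ M + M' := by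
      have : φ (m⁻¹ * n) = f (τ n v) - f (τ m v) := by
        rw [h1, map_add, map_smul, hf]; simp
      rw [this]
      exact (abs_sub _ _).trans (add_le_add (hM n hn) (hM' m hm))
    refine ⟨m * pow u (φ (m⁻¹ * n) / φ u), Set.mul_mem_mul hm ⟨_, ?_, rfl⟩, ?_⟩
    · rw [Set.mem_Icc, ← abs_le, abs_div]
      exact div_le_div_of_nonneg_right h2 (abs_nonneg _)
    · have h3 : τ (m⁻¹ * n) v = τ (pow u (φ (m⁻¹ * n) / φ u)) v := by
        rw [hφ _ hmn, hreal, div_mul_cancel₀ _ hφu]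
      rw [mul_inv_rev, mul_assoc, map_mul, Module.End.mul_apply, h3, ← Module.End.mul_apply,
        ← map_mul, inv_mul_cancel, map_one, Module.End.one_apply]

end IsPolynomialAlong

/-! ### Chevalley's theorem -/

theorem span_eq_top_of_separating {V : Type*} [AddCommGroup V] [Module ℝ V]
    [FiniteDimensional ℝ V] (S : Set (Module.Dual ℝ V))
    (hS : ∀ v, (∀ f ∈ S, f v = 0) → v = 0) : Submodule.span ℝ S = ⊤ := by
  rw [← Subspace.dualCoannihilator_dualAnnihilator_eq (W := Submodule.span ℝ S)]
  have : (Submodule.span ℝ S).dualCoannihilator = ⊥ := by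
    rw [eq_bot_iff]
    intro v hv
    rw [Submodule.mem_dualCoannihilator] at hv
    exact hS v fun f hf => hv f (Submodule.subset_span hf)
  rw [this, Submodule.dualAnnihilator_bot]

/-- By Cramer's rule, this determinant is the i-th coordinate of `y`. -/
theorem Module.Basis.exists_det_update_ne_zero {V : Type*} [AddCommGroup V] [Module ℝ V] {m : ℕ}
    (b : Module.Basis (Fin m) ℝ V) {y : V} (hy : y ≠ 0) :
    ∃ i, b.det (Function.update b i y) ≠ 0 := by
  by_contra hcon
  push Not at hcon
  refine hy (b.ext_elem fun i => ?_)
  have := hcon i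
  rw [Module.Basis.det_apply, Module.Basis.toMatrix_update, Module.Basis.toMatrix_self,
    ← Matrix.cramer_apply, Matrix.cramer_one] at this
  simpa using this

section chevalley

variable {n : ℕ}

/-- The functions on matrices that are polynomials of degree at most one. -/
def affineFun (n : ℕ) : Submodule ℝ (Matrix (Fin n) (Fin n) ℝ → ℝ) :=
  Submodule.span ℝ (insert 1 (Set.range fun (ij : Fin n × Fin n)
    (x : Matrix (Fin n) (Fin n) ℝ) => x ij.1 ij.2))

theorem one_le_affineFun : 1 ≤ affineFun n := by
  rw [Submodule.one_le]
  exact Submodule.subset_span (Set.mem_insert _ _)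

theorem affineFun_pow_mono {d e : ℕ} (h : d ≤ e) : affineFun n ^ d ≤ affineFun n ^ e :=
  pow_le_pow_right' one_le_affineFun h

instance (d : ℕ) : FiniteDimensional ℝ (affineFun n ^ d : Submodule ℝ _) := by
  rw [FiniteDimensional, Module.Finite.iff_fg]
  exact Submodule.FG.pow (Submodule.fg_span (Set.Finite.insert _ (Set.finite_range _))) d

theorem exists_mem_affineFun_pow {f : Matrix (Fin n) (Fin n) ℝ → ℝ} (hf : f ∈ polyFun n) :
    ∃ d, f ∈ affineFun n ^ d := by
  induction hf using Algebra.adjoin_induction with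
  | mem x hx => exact ⟨1, by rw [pow_one]; exact Submodule.subset_span (Set.mem_insert_of_mem _ hx)⟩
  | algebraMap r => exact ⟨0, by rw [pow_zero]; exact Submodule.algebraMap_mem r⟩
  | add f g _ _ hf hg =>
    obtain ⟨d, hd⟩ := hf
    obtain ⟨e, he⟩ := hg
    exact ⟨max d e, add_mem (affineFun_pow_mono (le_max_left _ _) hd)
      (affineFun_pow_mono (le_max_right _ _) he)⟩
  | mul f g _ _ hf hg =>
    obtain ⟨d, hd⟩ := hf
    obtain ⟨e, he⟩ := hg
    exact ⟨d + e, by rw [pow_add]; exact Submodule.mul_mem_mul hd he⟩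

theorem affineFun_pow_le_polyFun (d : ℕ) :
    affineFun n ^ d ≤ Subalgebra.toSubmodule (polyFun n) := by
  have h1 : affineFun n ≤ Subalgebra.toSubmodule (polyFun n) := by
    rw [affineFun, Submodule.span_le]
    rintro f (rfl | ⟨ij, rfl⟩)
    · exact one_mem (polyFun n)
    · exact coord_mem_polyFun ij.1 ij.2
  induction d with
  | zero =>
    rw [pow_zero, Submodule.one_le]
    exact one_mem (polyFun n)
  | succ d ih =>
    rw [pow_succ]
    refine Submodule.mul_le.2 fun f hf g hg => ?_
    exact mul_mem (S := Subalgebra ℝ _) (ih hf) (h1 hg)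

/-- Left translation of functions on matrices. -/
def translateFun (g : GL (Fin n) ℝ) :
    (Matrix (Fin n) (Fin n) ℝ → ℝ) →ₐ[ℝ] (Matrix (Fin n) (Fin n) ℝ → ℝ) where
  toFun w x := w (g.val * x)
  map_one' := rfl
  map_mul' _ _ := rfl
  map_zero' := rfl
  map_add' _ _ := rfl
  commutes' _ := rfl

theorem translateFun_mem {g : GL (Fin n) ℝ} {d : ℕ} {w : Matrix (Fin n) (Fin n) ℝ → ℝ}
    (hw : w ∈ affineFun n ^ d) : translateFun g w ∈ affineFun n ^ d := by
  have h1 : (affineFun n).map (translateFun g).toLinearMap ≤ affineFun n := by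
    rw [affineFun, Submodule.map_span, Submodule.span_le]
    rintro _ ⟨f, rfl | ⟨ij, rfl⟩, rfl⟩
    · exact Submodule.subset_span (Set.mem_insert _ _)
    · have : (translateFun g).toLinearMap (fun x => x ij.1 ij.2) =
          ∑ k, g.val ij.1 k • fun x : Matrix (Fin n) (Fin n) ℝ => x k ij.2 := by
        ext x
        simp only [Finset.sum_apply, Pi.smul_apply, smul_eq_mul]
        exact Matrix.mul_apply (M := g.val) (N := x)
      rw [this]
      exact Submodule.sum_mem _ fun k _ => Submodule.smul_mem _ _
        (Submodule.subset_span (Set.mem_insert_of_mem _ ⟨(k, ij.2), rfl⟩))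
  have h2 : (affineFun n ^ d).map (translateFun g).toLinearMap ≤ affineFun n ^ d := by
    rw [Submodule.map_pow]
    exact pow_le_pow_left' h1 d
  exact h2 ⟨w, hw, rfl⟩

theorem comp_mul_right_mem_polyFun {f : Matrix (Fin n) (Fin n) ℝ → ℝ} (hf : f ∈ polyFun n)
    (x : Matrix (Fin n) (Fin n) ℝ) : (fun g => f (g * x)) ∈ polyFun n := by
  induction hf using Algebra.adjoin_induction with
  | mem f hf =>
    obtain ⟨ij, rfl⟩ := hf
    exact linear_mem_polyFun (Matrix.entryLinearMap ℝ ℝ ij.1 ij.2 ∘ₗ LinearMap.mulRight ℝ x)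
  | algebraMap r => exact const_mem_polyFun r
  | add f g _ _ hf hg => exact add_mem hf hg
  | mul f g _ _ hf hg => exact mul_mem hf hg

/-- The Zariski closure is cut out by polynomials of bounded degree. -/
theorem exists_degree_bound (S : Set (GL (Fin n) ℝ)) : ∃ d, ∀ g : GL (Fin n) ℝ,
    (∀ w ∈ affineFun n ^ d, (∀ s ∈ S, w s.val = 0) → w g.val = 0) → g ∈ zariskiClosureSet S := by
  let I := MvPolynomial.vanishingIdeal ℝ (glEntries '' S)
  -- Hilbert's basis theorem: finitely many generators have bounded degree.
  obtain ⟨T, hT⟩ : I.FG := IsNoetherian.noetherian I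
  have hfun : ∀ p : MvPolynomial (Fin n × Fin n) ℝ, ∃ d,
      (fun x : Matrix (Fin n) (Fin n) ℝ => MvPolynomial.aeval (fun ij => x ij.1 ij.2) p)
        ∈ affineFun n ^ d := fun p => exists_mem_affineFun_pow (aeval_mem_polyFun p)
  choose d hd using hfun
  refine ⟨T.sup d, fun g hg => ?_⟩
  have hle : I ≤ RingHom.ker (MvPolynomial.aeval (R := ℝ) (glEntries g)) := by
    rw [← hT, Ideal.span_le]
    intro p hp
    refine hg _ (affineFun_pow_mono (Finset.le_sup hp) (hd p)) fun s hs => ?_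
    have hpI : p ∈ I := hT ▸ Ideal.subset_span hp
    exact (MvPolynomial.mem_vanishingIdeal_iff.1 hpI) _ ⟨s, hs, rfl⟩
  exact MvPolynomial.mem_zeroLocus_iff.2 fun p hp => hle hp

/-- **Chevalley's theorem**: the Zariski closure of a linear group contains the stabilizer of a
vector in a polynomial representation, and acts on this vector by scalars. -/
theorem exists_polynomial_representation (Γ : Subgroup (GL (Fin n) ℝ)) :
    ∃ (E : Type) (_ : AddCommGroup E) (_ : Module ℝ E) (_ : FiniteDimensional ℝ E)
      (π : Representation ℝ (GL (Fin n) ℝ) E) (v : E), v ≠ 0 ∧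
      (∀ (f : Module.Dual ℝ E) w, ∃ F ∈ polyFun n, ∀ g, f (π g w) = F g.val) ∧
      (∀ g ∈ zariskiClosure Γ, ∃ χ : ℝ, π g v = χ • v) ∧
      ∀ g, π g v = v → g ∈ zariskiClosure Γ := by
  obtain ⟨d, hd⟩ := exists_degree_bound (Γ : Set (GL (Fin n) ℝ))
  let W : Submodule ℝ (Matrix (Fin n) (Fin n) ℝ → ℝ) := affineFun n ^ d
  have : FiniteDimensional ℝ W := inferInstanceAs (FiniteDimensional ℝ (affineFun n ^ d : Submodule ℝ _))
  let l : GL (Fin n) ℝ → W →ₗ[ℝ] W := fun g =>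
    (translateFun g).toLinearMap.restrict fun _ hw => translateFun_mem hw
  have hl : ∀ g (w : W) x, (l g w).val x = w.val (g.val * x) := fun _ _ _ => rfl
  have hl1 : l 1 = LinearMap.id := by
    ext w x
    rw [hl, Units.val_one, one_mul, LinearMap.id_apply]
  have hlmul : ∀ g h, l (g * h) = l h ∘ₗ l g := fun g h => by
    ext w x
    rw [hl, Units.val_mul, mul_assoc]
    rfl
  let F : Submodule ℝ W :=
    { carrier := {w | ∀ γ ∈ Γ, w.val γ.val = 0}
      add_mem' := fun {u w} hu hw γ hγ => by
        change u.val γ.val + w.val γ.val = 0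
        rw [hu γ hγ, hw γ hγ, add_zero]
      zero_mem' := fun γ _ => rfl
      smul_mem' := fun c w hw γ hγ => by
        change c • w.val γ.val = 0
        rw [hw γ hγ, smul_zero] }
  let b := Module.finBasis ℝ (W ⧸ F)
  set m := Module.finrank ℝ (W ⧸ F)
  -- Translation `l` reverses products and precomposition reverses them again, so this is a
  -- homomorphism.
  let π : Representation ℝ (GL (Fin n) ℝ) (MultilinearMap ℝ (fun _ : Fin m => W) ℝ) :=
    { toFun := fun g =>
        { toFun := fun v => v.compLinearMap fun _ => l g
          map_add' := fun _ _ => rfl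
          map_smul' := fun _ _ => rfl }
      map_one' := by
        ext v w
        simp [hl1]
      map_mul' := fun g h => by
        ext v w
        simp only [hlmul]
        rfl }
  have hπ : ∀ g v w, π g v w = v fun j => l g (w j) := fun _ _ _ => rfl
  -- The volume form of W/F pulled back to W: it determines F, which plays the role of a line in an
  -- exterior power.
  let v : MultilinearMap ℝ (fun _ : Fin m => W) ℝ :=
    b.det.toMultilinearMap.compLinearMap fun _ => F.mkQ
  have hv : ∀ w, v w = b.det fun j => F.mkQ (w j) := fun _ => rfl
  refine ⟨MultilinearMap ℝ (fun _ : Fin m => W) ℝ, inferInstance, inferInstance, inferInstance, π,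
    v, ?_, ?_, ?_, ?_⟩
  · intro h0
    choose w hw using fun j => F.mkQ_surjective (b j)
    have := hv w
    rw [h0, funext hw, Module.Basis.det_self] at this
    exact zero_ne_one this
  · have hW : ∀ (φ : Module.Dual ℝ W) (w : W), ∃ P ∈ polyFun n, ∀ g, φ (l g w) = P g.val := by
      intro φ w
      have hφ : φ ∈ Submodule.span ℝ (Set.range fun x : Matrix (Fin n) (Fin n) ℝ =>
          (LinearMap.proj x ∘ₗ W.subtype : Module.Dual ℝ W)) := by
        rw [span_eq_top_of_separating]
        · trivial
        · intro u hu
          ext x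
          exact hu _ ⟨x, rfl⟩
      induction hφ using Submodule.span_induction with
      | mem φ hφ =>
        obtain ⟨x, rfl⟩ := hφ
        exact ⟨_, comp_mul_right_mem_polyFun (affineFun_pow_le_polyFun d w.2) x, fun g => rfl⟩
      | zero => exact ⟨0, zero_mem _, fun g => rfl⟩
      | add φ ψ _ _ hφ hψ =>
        obtain ⟨P, hP, hφ⟩ := hφ
        obtain ⟨Q, hQ, hψ⟩ := hψ
        exact ⟨P + Q, add_mem hP hQ, fun g => by rw [LinearMap.add_apply, hφ, hψ]; rfl⟩
      | smul c φ _ hφ =>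
        obtain ⟨P, hP, hφ⟩ := hφ
        exact ⟨c • P, Subalgebra.smul_mem _ hP c, fun g => by rw [LinearMap.smul_apply, hφ]; rfl⟩
    intro f u
    have hf : f ∈ Submodule.span ℝ (Set.range fun w : Fin m → W =>
        ({ toFun := fun u => u w
           map_add' := fun _ _ => rfl
           map_smul' := fun _ _ => rfl } :
          Module.Dual ℝ (MultilinearMap ℝ (fun _ : Fin m => W) ℝ))) := by
      rw [span_eq_top_of_separating]
      · trivial
      · intro u hu
        ext w
        exact hu _ ⟨w, rfl⟩
    induction hf using Submodule.span_induction with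
    | mem f hf =>
      obtain ⟨w, rfl⟩ := hf
      let c := Module.finBasis ℝ W
      choose P hP hPg using fun i j => hW (c.coord i) (w j)
      refine ⟨∑ r : Fin m → Fin (Module.finrank ℝ W), (∏ j, P (r j) j) * fun _ => u fun j => c (r j),
        sum_mem fun r _ => mul_mem (prod_mem fun j _ => hP _ _) (const_mem_polyFun _), fun g => ?_⟩
      change u (fun j => l g (w j)) = _
      have h1 : (fun j => l g (w j)) = fun j => ∑ i, P i j g.val • c i := by
        ext1 j
        conv_lhs => rw [← c.sum_repr (l g (w j))]
        refine Finset.sum_congr rfl fun i _ => ?_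
        rw [← hPg, Module.Basis.coord_apply]
      rw [h1, MultilinearMap.map_sum, Finset.sum_apply]
      refine Finset.sum_congr rfl fun r _ => ?_
      rw [MultilinearMap.map_smul_univ, Pi.mul_apply, Finset.prod_apply, smul_eq_mul]
    | zero => exact ⟨0, zero_mem _, fun g => rfl⟩
    | add φ ψ _ _ hφ hψ =>
      obtain ⟨P, hP, hφ⟩ := hφ
      obtain ⟨Q, hQ, hψ⟩ := hψ
      exact ⟨P + Q, add_mem hP hQ, fun g => by rw [LinearMap.add_apply, hφ, hψ]; rfl⟩
    | smul c φ _ hφ =>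
      obtain ⟨P, hP, hφ⟩ := hφ
      exact ⟨c • P, Subalgebra.smul_mem _ hP c, fun g => by rw [LinearMap.smul_apply, hφ]; rfl⟩
  · intro g hg
    have hF : F ≤ F.comap (l g) := fun w hw γ hγ => by
      rw [hl]
      exact eq_zero_of_mem_zariskiClosure
        ((zariskiClosure Γ).mul_mem hg (le_zariskiClosure Γ hγ))
        (affineFun_pow_le_polyFun d w.2) hw
    refine ⟨LinearMap.det (F.mapQ F (l g) hF), ?_⟩
    ext w
    rw [hπ, hv, smul_apply, hv, smul_eq_mul, ← Module.Basis.det_comp]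
    rfl
  · intro s hs
    have hsurj : Function.Surjective (l s) := fun w => ⟨l s⁻¹ w, by
      rw [← LinearMap.comp_apply, ← hlmul, inv_mul_cancel, hl1, LinearMap.id_apply]⟩
    refine hd s fun w hw hwΓ => ?_
    have hwF : (⟨w, hw⟩ : W) ∈ F := hwΓ
    -- Otherwise the image of `l s w` in W/F could replace a basis vector without making the volume
    -- zero. But `s` fixes `v`, and `v` vanishes when one argument lies in F.
    have hlF : l s ⟨w, hw⟩ ∈ F := by
      rw [← Submodule.Quotient.mk_eq_zero]
      by_contra hy
      obtain ⟨i, hi⟩ := b.exists_det_update_ne_zero hy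
      choose u hu using fun j => (F.mkQ_surjective.comp hsurj) (b j)
      have h1 : v (fun j => l s (Function.update u i ⟨w, hw⟩ j)) ≠ 0 := by
        rw [hv]
        convert hi using 2
        ext1 j
        by_cases hj : j = i
        · subst hj; simp
        · simp only [Function.update_of_ne hj]
          exact hu j
      rw [← hπ, hs, hv] at h1
      refine h1 (b.det.map_coord_zero i ?_)
      rw [Function.update_self]
      exact (Submodule.Quotient.mk_eq_zero F).2 hwF
    have := hlF 1 Γ.one_mem
    rwa [hl, Units.val_one, mul_one] at this

end chevalley

/-! ### Compactness in the general linear group -/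

section topology

variable {n : ℕ}

/-- The topology on units also involves the inverse, whose continuity follows from the adjugate
formula. -/
theorem continuous_gl_iff {X : Type*} [TopologicalSpace X] {f : X → GL (Fin n) ℝ} :
    Continuous f ↔ Continuous fun x => (f x).val := by
  refine ⟨fun h => Units.continuous_val.comp h, fun h => Units.continuous_iff.2 ⟨h, ?_⟩⟩
  have h1 : (fun x => ((f x)⁻¹).val) = fun x => (f x).val.det⁻¹ • (f x).val.adjugate := by
    ext1 x
    rw [Matrix.coe_units_inv, Matrix.inv_def, Ring.inverse_eq_inv']
  rw [h1]
  have h0 : ∀ x, (f x).val.det ≠ 0 := fun x =>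
    ((Matrix.isUnit_iff_isUnit_det _).1 (f x).isUnit).ne_zero
  exact (h.matrix_det.inv₀ h0).smul h.matrix_adjugate

theorem isCompact_matrix_entries_le (M : ℝ) :
    IsCompact {x : Matrix (Fin n) (Fin n) ℝ | ∀ i j, |x i j| ≤ M} := by
  have h1 : IsCompact (Set.pi Set.univ fun _ : Fin n => Set.pi Set.univ fun _ : Fin n =>
      Set.Icc (-M) M) := isCompact_univ_pi fun _ => isCompact_univ_pi fun _ => isCompact_Icc
  have h2 : {x : Matrix (Fin n) (Fin n) ℝ | ∀ i j, |x i j| ≤ M} = Set.pi Set.univ fun _ : Fin n =>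
      Set.pi Set.univ fun _ : Fin n => Set.Icc (-M) M := by
    refine Set.ext fun x => ?_
    exact ⟨fun h i _ j _ => abs_le.1 (h i j), fun h i j => abs_le.2 (h i trivial j trivial)⟩
  rw [h2]
  exact h1

theorem isCompact_gl_entries_le (M : ℝ) {δ : ℝ} (hδ : 0 < δ) :
    IsCompact {g : GL (Fin n) ℝ | (∀ i j, |g.val i j| ≤ M) ∧ δ ≤ |g.val.det|} := by
  let X : Set (Matrix (Fin n) (Fin n) ℝ) := {x | (∀ i j, |x i j| ≤ M) ∧ δ ≤ |x.det|}
  have hX : IsCompact X := (isCompact_matrix_entries_le M).inter_right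
    (isClosed_le continuous_const continuous_id.matrix_det.abs)
  have hX0 : ∀ x : X, x.val.det ≠ 0 := fun x => abs_pos.1 (hδ.trans_le x.2.2)
  let f : X → GL (Fin n) ℝ := fun x => Matrix.GeneralLinearGroup.mkOfDetNeZero x.val (hX0 x)
  have hf : Continuous f := continuous_gl_iff.2 continuous_subtype_val
  have : CompactSpace X := isCompact_iff_compactSpace.1 hX
  convert isCompact_range hf using 1
  ext g
  constructor
  · intro hg
    exact ⟨⟨g.val, hg⟩, Units.ext rfl⟩
  · rintro ⟨x, rfl⟩
    exact x.2

/-- The characteristic polynomial of -a is Xⁿ; evaluate it at 1. -/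
theorem Matrix.det_one_add_of_isNilpotent {a : Matrix (Fin n) (Fin n) ℝ} (ha : IsNilpotent a) :
    (1 + a).det = 1 := by
  have h1 := (Matrix.isNilpotent_charpoly_sub_pow_of_isNilpotent ha.neg).eq_zero
  rw [sub_eq_zero] at h1
  have h2 := congrArg (Polynomial.eval 1) h1
  rw [Matrix.eval_charpoly] at h2
  simpa using h2

end topology

/-! ### Compactness of the quotient by the unipotent radical -/

section radicalGroup

variable {n : ℕ} {Γ : Subgroup (GL (Fin n) ℝ)}

theorem exists_mem_radicalGroup_val_eq {a : Matrix (Fin n) (Fin n) ℝ} (ha : a ∈ traceRadical Γ) :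
    ∃ u ∈ radicalGroup Γ, u.val = 1 + a := by
  obtain ⟨u, hu⟩ := (isNilpotent_of_mem_traceRadical ha).isUnit_one_add
  exact ⟨u, by rw [mem_radicalGroup, hu, add_sub_cancel_left]; exact ha, hu⟩

theorem pow_succ_mem_traceRadical {a : Matrix (Fin n) (Fin n) ℝ} (ha : a ∈ traceRadical Γ)
    (i : ℕ) : a ^ (i + 1) ∈ traceRadical Γ := by
  rw [pow_succ]
  exact mul_traceRadical_mem ha (pow_mem ha.1 i)

/-- Unipotent matrices have real powers given by the binomial series. -/
theorem exists_real_powers (Γ : Subgroup (GL (Fin n) ℝ)) :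
    ∃ pow : radicalGroup Γ → ℝ → radicalGroup Γ, (∀ u (k : ℕ), pow u k = u ^ k) ∧
      (∀ u i j, ∃ p : Polynomial ℝ, ∀ t, (pow u t).val.val i j = p.eval t) ∧
      ∀ u, Continuous (pow u) := by
  have hr : ∀ u : radicalGroup Γ, ∃ r : ℕ, (u.val.val - 1) ^ r = 0 := fun u =>
    isNilpotent_of_mem_radicalGroup u.2
  choose r hr using hr
  let β : ℕ → Polynomial ℝ := fun i => Polynomial.C ((i.factorial : ℝ)⁻¹) * descPochhammer ℝ i
  have hβ : ∀ i k : ℕ, (β i).eval (k : ℝ) = k.choose i := fun i k => by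
    simp only [β]
    rw [Polynomial.eval_mul, Polynomial.eval_C, descPochhammer_eval_eq_descFactorial,
      Nat.descFactorial_eq_factorial_mul_choose, Nat.cast_mul,
      inv_mul_cancel_left₀ (Nat.cast_ne_zero.2 i.factorial_ne_zero)]
  -- The constant term is split off so that the remaining sum lies in the trace radical.
  have hex : ∀ (u : radicalGroup Γ) (t : ℝ), ∃ w ∈ radicalGroup Γ, w.val =
      1 + ∑ i ∈ Finset.range (r u), (β (i + 1)).eval t • (u.val.val - 1) ^ (i + 1) := fun u t =>
    exists_mem_radicalGroup_val_eq (sum_mem fun i _ => Submodule.smul_mem _ _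
      (pow_succ_mem_traceRadical u.2 i))
  choose w hw hwval using hex
  have hpoly : ∀ u i j, ∃ p : Polynomial ℝ, ∀ t, (w u t).val i j = p.eval t := by
    intro u i j
    refine ⟨Polynomial.C ((1 : Matrix (Fin n) (Fin n) ℝ) i j) + ∑ k ∈ Finset.range (r u),
      β (k + 1) * Polynomial.C (((u.val.val - 1) ^ (k + 1)) i j), fun t => ?_⟩
    rw [hwval, Matrix.add_apply, Matrix.sum_apply, Polynomial.eval_add, Polynomial.eval_C,
      Polynomial.eval_finsetSum]
    simp
  refine ⟨fun u t => ⟨w u t, hw u t⟩, fun u k => ?_, hpoly, fun u => ?_⟩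
  · refine Subtype.ext (Units.ext ?_)
    change (w u k).val = _
    rw [hwval, Subgroup.coe_pow, Units.val_pow_eq_pow_val]
    set a := u.val.val - 1
    have hu : u.val.val = a + 1 := by simp [a]
    have h1 : ∀ s, r u < s → k < s →
        (a + 1) ^ k = ∑ i ∈ Finset.range s, (k.choose i : ℝ) • a ^ i := by
      intro s _ hs
      rw [(Commute.one_right a).add_pow]
      refine (Finset.sum_subset (Finset.range_subset_range.2 hs) fun i _ hi => ?_).trans
        (Finset.sum_congr rfl fun i _ => ?_)
      · rw [Nat.choose_eq_zero_of_lt (by simpa using hi)]; simp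
      · rw [one_pow, mul_one, ← nsmul_eq_mul', Nat.cast_smul_eq_nsmul]
    -- A common length for both sums: the terms beyond k vanish by the binomial coefficient, those
    -- from `r u` on by nilpotency.
    rw [hu, h1 (r u + k + 1) (by omega) (by omega), Finset.sum_range_succ']
    simp only [Nat.choose_zero_right, Nat.cast_one, pow_zero, one_smul, hβ]
    rw [add_comm]
    congr 1
    refine Finset.sum_subset (Finset.range_subset_range.2 (by omega)) fun i _ hi => ?_
    have : r u ≤ i + 1 := by
      have : r u ≤ i := by simpa using hi
      omega
    rw [pow_eq_zero_of_le this (hr u), smul_zero]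
  · refine Continuous.subtype_mk (continuous_gl_iff.2 (continuous_matrix fun i j => ?_)) _
    obtain ⟨p, hp⟩ := hpoly u i j
    simp only [hp]
    exact p.continuous

/-- Modulo unipotent elements, the Zariski closure lies in a compact set. -/
theorem exists_compact_reduction
    (hΓ : Bornology.IsBounded ((fun γ : GL (Fin n) ℝ => γ.val.trace) '' (Γ : Set (GL (Fin n) ℝ)))) :
    ∃ K : Set (GL (Fin n) ℝ), IsCompact K ∧
      ∀ g ∈ zariskiClosure Γ, ∃ u ∈ radicalGroup Γ, u * g ∈ K := by
  obtain ⟨c, hc, M, hM⟩ := exists_bounded_projection hΓ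
  have hu : ∀ g ∈ zariskiClosure Γ, ∃ u ∈ radicalGroup Γ, (u * g).val = c g.val := by
    intro g hg
    have h1 := mem_envelope_of_mem_zariskiClosure hg
    have h2 := mem_envelope_of_mem_zariskiClosure ((zariskiClosure Γ).inv_mem hg)
    -- The choice u = 1 - (g - c g) g⁻¹ gives u g = c g. This `u` need not lie in the Zariski
    -- closure.
    obtain ⟨u, hu, huval⟩ := exists_mem_radicalGroup_val_eq
      (neg_mem (traceRadical_mul_mem (hc _ h1) h2))
    refine ⟨u, hu, ?_⟩
    rw [Units.val_mul, huval, add_mul, one_mul, neg_mul, mul_assoc, ← Units.val_mul,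
      inv_mul_cancel, Units.val_one, mul_one]
    abel
  have hdet : ∀ u ∈ radicalGroup Γ, u.val.det = 1 := fun u hu => by
    have := Matrix.det_one_add_of_isNilpotent (isNilpotent_of_mem_radicalGroup hu)
    rwa [add_sub_cancel] at this
  obtain ⟨B, hB⟩ := (isCompact_matrix_entries_le (n := n) M).exists_bound_of_continuousOn
    (f := Matrix.det) continuous_id.matrix_det.continuousOn
  have hdetG : ∀ g ∈ zariskiClosure Γ, |g.val.det| ≤ B := by
    intro g hg
    obtain ⟨u, hu, huval⟩ := hu g hg
    have h1 := hB _ (hM g hg)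
    rwa [← huval, Units.val_mul, Matrix.det_mul, hdet u hu, one_mul] at h1
  have hB1 : 1 ≤ B := by
    simpa using hdetG 1 (zariskiClosure Γ).one_mem
  refine ⟨_, isCompact_gl_entries_le M (δ := B⁻¹) (by positivity), fun g hg => ?_⟩
  obtain ⟨u, hu, huval⟩ := hu g hg
  refine ⟨u, hu, fun i j => by rw [huval]; exact hM g hg i j, ?_⟩
  rw [Units.val_mul, Matrix.det_mul, hdet u hu, one_mul]
  -- Bounding the determinant of the inverse keeps `g` away from the singular matrices.
  have h1 := hdetG g⁻¹ ((zariskiClosure Γ).inv_mem hg)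
  have h2 : |g.val.det| * |(g⁻¹).val.det| = 1 := by
    rw [← abs_mul, ← Matrix.det_mul, ← Units.val_mul, mul_inv_cancel]; simp
  rw [inv_le_iff_one_le_mul₀ (by linarith)]
  nlinarith [abs_nonneg g.val.det]

/-- The quotient of the Zariski closure by its unipotent radical is compact. -/
theorem compactSpace_quotient_unipotentRadical
    (hΓ : Bornology.IsBounded ((fun γ : GL (Fin n) ℝ => γ.val.trace) '' (Γ : Set (GL (Fin n) ℝ)))) :
    CompactSpace (zariskiClosure Γ ⧸ unipotentRadical (zariskiClosure Γ)) := by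
  obtain ⟨K₀, hK₀, hred⟩ := exists_compact_reduction hΓ
  obtain ⟨E, _, _, _, π, v, hv, hπ, hχ, hstab⟩ := exists_polynomial_representation Γ
  obtain ⟨pow, hnat, hpoly, hcont⟩ := exists_real_powers Γ
  have hπcont : ∀ (f : Module.Dual ℝ E) w, Continuous fun g => f (π g w) := fun f w => by
    obtain ⟨F, hF, hFg⟩ := hπ f w
    simp only [hFg]
    exact (continuous_of_mem_polyFun hF).comp Units.continuous_val
  let τ : Representation ℝ (radicalGroup Γ) E := π.comp (radicalGroup Γ).subtype
  have hτ : IsPolynomialAlong pow τ := ⟨hnat, fun u f w => by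
    obtain ⟨F, hF, hFg⟩ := hπ f w
    obtain ⟨p, hp⟩ := exists_polynomial_of_mem_polyFun hF (fun t => (pow u t).val.val) (hpoly u)
    exact ⟨p, fun t => (hFg _).trans (hp t)⟩⟩
  choose! χ hχ using hχ
  -- Since f₀((u g) v) = χ(g) f₀(v), with u g in the compact set `K₀` for a suitable u, this
  -- functional bounds the character.
  obtain ⟨f₀, hf₀, hf₀inv⟩ := hτ.exists_invariant_functional hv
  obtain ⟨B, hB⟩ := hK₀.exists_bound_of_continuousOn (hπcont f₀ v).continuousOn
  have hπu : ∀ g ∈ zariskiClosure Γ, ∀ u, π (u * g) v = χ g • π u v := fun g hg u => by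
    rw [map_mul, Module.End.mul_apply, hχ g hg, map_smul]
  have hχB : ∀ g ∈ zariskiClosure Γ, |χ g| ≤ B / |f₀ v| := by
    intro g hg
    obtain ⟨u, hu, hug⟩ := hred g hg
    have h1 := hB _ hug
    rw [hπu g hg, map_smul, show f₀ (π u v) = f₀ v from hf₀inv ⟨u, hu⟩, smul_eq_mul, Real.norm_eq_abs, abs_mul] at h1
    rwa [le_div_iff₀ (abs_pos.2 hf₀)]
  have hχinv : ∀ g ∈ zariskiClosure Γ, χ g⁻¹ * χ g = 1 := by
    intro g hg
    have h1 := hπu g hg g⁻¹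
    rw [inv_mul_cancel, map_one, Module.End.one_apply, hχ _ (inv_mem hg), smul_smul,
      mul_comm] at h1
    have h2 : (χ g⁻¹ * χ g - 1) • v = 0 := by rw [sub_smul, one_smul, ← h1, sub_self]
    exact sub_eq_zero.1 ((smul_eq_zero.1 h2).resolve_right hv)
  obtain ⟨K, hK, hCK⟩ := hτ.exists_isCompact_mul_stabilizer hcont
    (fun f w => (hπcont f w).comp continuous_subtype_val) v
    {u | ∃ g ∈ zariskiClosure Γ, u.val * g ∈ K₀} (fun f => by
      obtain ⟨B', hB'⟩ := hK₀.exists_bound_of_continuousOn (hπcont f v).continuousOn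
      refine ⟨B / |f₀ v| * B', ?_⟩
      rintro u ⟨g, hg, hug⟩
      -- Both factors are bounded: the character by `hχB`, the vector because u g lies in `K₀`.
      have h1 : τ u v = χ g⁻¹ • π (u.val * g) v := by
        rw [hπu g hg, smul_smul, hχinv g hg, one_smul]
        rfl
      rw [h1, map_smul, smul_eq_mul, abs_mul]
      have h2 := hχB _ (inv_mem hg)
      exact mul_le_mul h2 (hB' _ hug) (abs_nonneg _) ((abs_nonneg _).trans h2))
  open scoped Pointwise in
  let Q : Set (GL (Fin n) ℝ) := (Subtype.val '' K)⁻¹ * K₀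
  have hQ : IsCompact Q := (hK.image continuous_subtype_val).inv.mul hK₀
  have hQG : IsCompact ((Subtype.val : zariskiClosure Γ → GL (Fin n) ℝ) ⁻¹' Q) :=
    (isClosed_zariskiClosureSet _).isClosedEmbedding_subtypeVal.isCompact_preimage hQ
  refine ⟨?_⟩
  convert hQG.image (QuotientGroup.continuous_mk (N := unipotentRadical (zariskiClosure Γ)))
  rw [eq_comm, Set.eq_univ_iff_forall]
  intro q
  obtain ⟨g, rfl⟩ := QuotientGroup.mk_surjective q
  obtain ⟨u, hu, hug⟩ := hred g g.2
  obtain ⟨m, hm, hstabm⟩ := hCK ⟨u, hu⟩ ⟨g, g.2, hug⟩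
  -- This element fixes v, so it lies in the closure. It is also in `radicalGroup Γ`, hence in the
  -- unipotent radical, and multiplying `g` by it does not change the coset.
  have hs : m.val⁻¹ * u ∈ zariskiClosure Γ := hstab _ hstabm
  set s : zariskiClosure Γ := ⟨m.val⁻¹ * u, hs⟩
  have hsU : s ∈ unipotentRadical (zariskiClosure Γ) :=
    mem_unipotentRadical_iff.2 (mul_mem (inv_mem m.2) hu)
  refine ⟨s * g, ?_, ?_⟩
  · have : (s * g).val = m.val⁻¹ * (u * g) := mul_assoc _ _ _
    rw [Set.mem_preimage, this]
    exact Set.mul_mem_mul (Set.inv_mem_inv.2 ⟨m, hm, rfl⟩) hug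
  · rw [QuotientGroup.mk_mul, (QuotientGroup.eq_one_iff s).2 hsU, one_mul]

end radicalGroup

/-! ### Amenability from polynomial growth -/

section mean

variable {G : Type*} [Group G] [TopologicalSpace G] [IsTopologicalGroup G]

theorem abs_apply_le_norm_of_mean {G : Type*} [TopologicalSpace G] {m : (G →ᵇ ℝ) →ₗ[ℝ] ℝ}
    (hpos : ∀ f : G →ᵇ ℝ, (∀ x, 0 ≤ f x) → 0 ≤ m f)
    (hone : m (BoundedContinuousFunction.const G 1) = 1) (f : G →ᵇ ℝ) : |m f| ≤ ‖f‖ := by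
  have h1 := hpos (‖f‖ • BoundedContinuousFunction.const G 1 - f) fun x => by
    have := (le_abs_self _).trans (f.norm_coe_le_norm x)
    simpa using this
  have h2 := hpos (‖f‖ • BoundedContinuousFunction.const G 1 + f) fun x => by
    have := (neg_le_abs _).trans (f.norm_coe_le_norm x)
    simp only [BoundedContinuousFunction.coe_add, Pi.add_apply,
      BoundedContinuousFunction.coe_smul, BoundedContinuousFunction.const_apply, smul_eq_mul,
      mul_one]
    linarith
  rw [map_sub, map_smul, hone, smul_eq_mul, mul_one] at h1
  rw [map_add, map_smul, hone, smul_eq_mul, mul_one] at h2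
  rw [abs_le]
  constructor <;> linarith

/-- A group with almost invariant means is amenable. -/
theorem isAmenable_of_almost_invariant
    (h : ∀ (T : Finset G) (ε : ℝ), 0 < ε → ∃ m : (G →ᵇ ℝ) →ₗ[ℝ] ℝ,
      (∀ f : G →ᵇ ℝ, (∀ x, 0 ≤ f x) → 0 ≤ m f) ∧
      m (BoundedContinuousFunction.const G 1) = 1 ∧
      ∀ g ∈ T, ∀ f : G →ᵇ ℝ, |m (leftTranslate g f) - m f| ≤ ε * ‖f‖) : IsAmenable G := by
  classical
  choose m hpos hone hinv using fun i : Finset G × ℕ => h i.1 (1 / (i.2 + 1)) (by positivity)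
  -- Means are bounded by the norm, so an ultrafilter limit exists for every function; along it the
  -- finite set grows and the error tends to zero.
  let U : Ultrafilter (Finset G × ℕ) := Ultrafilter.of Filter.atTop
  have hU : (U : Filter (Finset G × ℕ)) ≤ Filter.atTop := Ultrafilter.of_le _
  have hlim : ∀ f : G →ᵇ ℝ, ∃ L, Filter.Tendsto (fun i => m i f) U (nhds L) := fun f => by
    obtain ⟨L, -, hL⟩ := (isCompact_Icc (a := -‖f‖) (b := ‖f‖)).ultrafilter_le_nhds
      (U.map fun i => m i f) (by
        rw [Filter.le_principal_iff]
        exact Filter.mem_map.2 <| Filter.univ_mem' fun i =>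
          abs_le.1 (abs_apply_le_norm_of_mean (hpos i) (hone i) f))
    exact ⟨L, hL⟩
  choose L hL using hlim
  refine ⟨{ toFun := L, map_add' := fun f g => ?_, map_smul' := fun c f => ?_ }, fun f hf => ?_, ?_,
    fun g f => ?_⟩
  · refine tendsto_nhds_unique (hL (f + g)) ?_
    simpa only [map_add] using (hL f).add (hL g)
  · refine tendsto_nhds_unique (hL (c • f)) ?_
    simpa only [map_smul, RingHom.id_apply] using (hL f).const_smul c
  · exact ge_of_tendsto' (hL f) fun i => hpos i f hf
  · refine tendsto_nhds_unique (hL _) ?_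
    simp only [hone]
    exact tendsto_const_nhds
  · change L _ = L f
    rw [← sub_eq_zero]
    refine tendsto_nhds_unique ((hL (leftTranslate g f)).sub (hL f)) ?_
    have h0 : Filter.Tendsto (fun i : Finset G × ℕ => 1 / ((i.2 : ℝ) + 1) * ‖f‖) U (nhds 0) := by
      have h1 : Filter.Tendsto (fun i : Finset G × ℕ => i.2) U Filter.atTop := by
        refine Filter.Tendsto.mono_left ?_ hU
        rw [← Filter.prod_atTop_atTop_eq]
        exact Filter.tendsto_snd
      simpa using (tendsto_one_div_add_atTop_nhds_zero_nat.comp h1).mul_const ‖f‖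
    refine squeeze_zero_norm' ?_ h0
    have h2 : ∀ᶠ i : Finset G × ℕ in U, ({g}, 0) ≤ i := hU (Filter.eventually_ge_atTop _)
    filter_upwards [h2] with i hi
    exact hinv i g (hi.1 (Finset.mem_singleton_self g)) f

open MeasureTheory

/-- The mean value of bounded continuous functions on a set of finite positive measure. -/
noncomputable def averageOn {G : Type*} [TopologicalSpace G] [MeasurableSpace G] [BorelSpace G] (μ : Measure G) (F : Set G) :
    (G →ᵇ ℝ) → ℝ := fun f => (μ.real F)⁻¹ * ∫ x in F, f x ∂μ

theorem integrableOn_boundedContinuous {G : Type*} [TopologicalSpace G] [MeasurableSpace G] [BorelSpace G] {μ : Measure G}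
    {F : Set G} (hF : μ F ≠ ⊤) (f : G →ᵇ ℝ) : IntegrableOn f F μ := by
  have : IsFiniteMeasure (μ.restrict F) := isFiniteMeasure_restrict.2 hF
  exact f.integrable _

/-- A pair of sets `F ⊆ F'` of almost the same measure with `g F ⊆ F'` gives a mean that is almost
invariant under `g`. -/
theorem abs_averageOn_sub_le [MeasurableSpace G] [BorelSpace G] {μ : Measure G}
    [μ.IsMulLeftInvariant] {F F' : Set G} (hF : MeasurableSet F)
    (hpos : 0 < μ.real F) (hfin' : μ F' ≠ ⊤) (hFF' : F ⊆ F') {ε : ℝ}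
    (hε : μ.real F' ≤ (1 + ε) * μ.real F) {g : G} (hg : ∀ x ∈ F, g * x ∈ F') (f : G →ᵇ ℝ) :
    |averageOn μ F (leftTranslate g f) - averageOn μ F f| ≤ 2 * ε * ‖f‖ := by
  -- Used for both F and g F: each integral is close to the one over `F'`.
  have key : ∀ A, MeasurableSet A → A ⊆ F' → μ A = μ F →
      |∫ x in F', f x ∂μ - ∫ x in A, f x ∂μ| ≤ ε * μ.real F * ‖f‖ := by
    intro A hA hAF' hAF
    rw [← setIntegral_sdiff hA (integrableOn_boundedContinuous hfin' f) hAF']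
    have h1 : μ (F' \ A) ≠ ⊤ := ne_top_of_le_ne_top hfin' (measure_mono Set.sdiff_subset)
    have h2 := norm_setIntegral_le_of_norm_le_const (μ := μ) (f := f) (C := ‖f‖) h1.lt_top
      fun x _ => f.norm_coe_le_norm x
    have h3 : μ.real (F' \ A) = μ.real F' - μ.real F := by
      rw [measureReal_sdiff hAF' hA hfin']
      simp only [Measure.real, hAF]
    rw [h3] at h2
    refine h2.trans ?_
    rw [mul_comm]
    exact mul_le_mul_of_nonneg_right (by linarith) (norm_nonneg f)
  let φ : G ≃ᵐ G := (Homeomorph.mulLeft g).toMeasurableEquiv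
  have hφ : MeasurePreserving φ μ μ := measurePreserving_mul_left μ g
  have hpre : φ ⁻¹' (φ '' F) = F := φ.injective.preimage_image F
  have himg : MeasurableSet (φ '' F) := φ.measurableSet_image.2 hF
  have htrans : ∫ x in F, leftTranslate g f x ∂μ = ∫ x in φ '' F, f x ∂μ := by
    rw [← hφ.setIntegral_preimage_emb φ.measurableEmbedding f, hpre]
    rfl
  have hμ : μ (φ '' F) = μ F := by
    rw [← hφ.measure_preimage himg.nullMeasurableSet, hpre]
  have h1 := key F hF hFF' rfl
  have h2 := key _ himg (by rintro _ ⟨x, hx, rfl⟩; exact hg x hx) hμ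
  rw [averageOn, averageOn, htrans, ← mul_sub, abs_mul, abs_inv, abs_of_pos hpos,
    inv_mul_le_iff₀ hpos]
  rw [abs_le] at h1 h2 ⊢
  constructor <;> nlinarith

/-- Otherwise the sequence would grow exponentially. -/
theorem exists_succ_le_of_polynomial_growth {a : ℕ → ℝ} (ha : 0 < a 0) {C : ℝ} {D : ℕ}
    (hC : ∀ k, a k ≤ C * ((k : ℝ) + 1) ^ D) {ε : ℝ} (hε : 0 < ε) :
    ∃ k, a (k + 1) ≤ (1 + ε) * a k := by
  by_contra hcon
  push Not at hcon
  have h1 : ∀ k, (1 + ε) ^ k * a 0 ≤ a k := by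
    intro k
    induction k with
    | zero => simp
    | succ k ih =>
      rw [pow_succ', mul_assoc]
      exact (mul_le_mul_of_nonneg_left ih (by linarith)).trans (hcon k).le
  have h2 := (tendsto_pow_const_div_const_pow_of_one_lt D (show (1 : ℝ) < 1 + ε by linarith)).comp
    (Filter.tendsto_add_atTop_nat 1)
  have h3 := h2.const_mul (C * (1 + ε))
  rw [mul_zero] at h3
  refine absurd (ge_of_tendsto' h3 fun k => ?_) (not_le.2 ha)
  have h4 := (h1 k).trans (hC k)
  have hp : 0 < (1 + ε) ^ k := by positivity
  simp only [Function.comp_apply]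
  push_cast
  rw [pow_succ (1 + ε), mul_comm C, mul_assoc, ← mul_div_assoc, mul_div_assoc', le_div_iff₀ (by positivity)]
  nlinarith

open scoped Pointwise in
/-- A locally compact group of polynomial growth is amenable. -/
theorem isAmenable_of_polynomial_growth [T2Space G] [LocallyCompactSpace G] [MeasurableSpace G]
    [BorelSpace G] (μ : Measure G) [μ.IsHaarMeasure]
    (h : ∀ S : Set G, IsCompact S → ∃ (C : ℝ) (D : ℕ), ∀ k : ℕ,
      μ.real (S ^ k) ≤ C * ((k : ℝ) + 1) ^ D) : IsAmenable G := by
  refine isAmenable_of_almost_invariant fun T ε hε => ?_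
  obtain ⟨V, hV, hV1⟩ := exists_compact_mem_nhds (1 : G)
  -- The neighbourhood `V` gives the powers positive measure, and `T` contains the translations to
  -- be controlled.
  set S : Set G := V ∪ T
  have hS : IsCompact S := hV.union T.finite_toSet.isCompact
  have h1S : (1 : G) ∈ S := Or.inl (mem_of_mem_nhds hV1)
  have hSk : ∀ k, IsCompact (S ^ k) := fun k => by
    induction k with
    | zero => rw [pow_zero]; exact isCompact_singleton
    | succ k ih => rw [pow_succ]; exact ih.mul hS
  obtain ⟨C, D, hCD⟩ := h S hS
  have hmono : ∀ k, S ^ k ⊆ S ^ (k + 1) := fun k => Set.pow_subset_pow_right h1S (Nat.le_succ k)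
  have hpos : ∀ k, 0 < μ.real (S ^ (k + 1)) := fun k => by
    refine ENNReal.toReal_pos ?_ (hSk _).measure_lt_top.ne
    have h1 : 0 < μ V := μ.measure_pos_of_mem_nhds hV1
    have h2 : V ⊆ S ^ (k + 1) := by
      have h3 : V ⊆ S := Set.subset_union_left
      refine h3.trans ?_
      conv_lhs => rw [← pow_one S]
      exact Set.pow_subset_pow_right h1S (by omega)
    exact (h1.trans_le (measure_mono h2)).ne'
  -- The exponent starts at 1 because `S ^ 0` is a point, possibly null. The shift costs 2 ^ D, as k
  -- + 2 ≤ 2 (k + 1); half of ε offsets the factor 2 in `abs_averageOn_sub_le`.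
  obtain ⟨k, hk⟩ := exists_succ_le_of_polynomial_growth (a := fun k => μ.real (S ^ (k + 1)))
    (hpos 0) (C := C * 2 ^ D) (D := D) (fun k => by
      refine (hCD (k + 1)).trans ?_
      have hC0 : 0 ≤ C := by
        have := measureReal_nonneg.trans (hCD 0)
        simpa using this
      rw [mul_assoc, ← mul_pow]
      refine mul_le_mul_of_nonneg_left (pow_le_pow_left₀ (by positivity) ?_ D) hC0
      push_cast
      linarith [(Nat.cast_nonneg k : (0 : ℝ) ≤ k)]) (half_pos hε)
  set F := S ^ (k + 1)
  have hF : MeasurableSet F := (hSk _).isClosed.measurableSet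
  have hFfin : μ F ≠ ⊤ := (hSk _).measure_lt_top.ne
  refine ⟨{ toFun := averageOn μ F, map_add' := fun f g => ?_, map_smul' := fun c f => ?_ },
    fun f hf => ?_, ?_, fun g hg f => ?_⟩
  · simp only [averageOn, BoundedContinuousFunction.coe_add, Pi.add_apply]
    rw [integral_add (integrableOn_boundedContinuous hFfin f)
      (integrableOn_boundedContinuous hFfin g), mul_add]
  · simp only [averageOn, BoundedContinuousFunction.coe_smul, smul_eq_mul, RingHom.id_apply]
    rw [integral_const_mul]
    ring
  · exact mul_nonneg (inv_nonneg.2 measureReal_nonneg) (integral_nonneg hf)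
  · change averageOn μ F _ = 1
    simp only [averageOn, BoundedContinuousFunction.const_apply]
    rw [setIntegral_const, smul_eq_mul, mul_one]
    exact inv_mul_cancel₀ (hpos k).ne'
  · have := abs_averageOn_sub_le hF (hpos k) (hSk (k + 2)).measure_lt_top.ne (hmono (k + 1)) hk
      (g := g) (fun x hx => by
        rw [pow_succ' S (k + 1)]
        exact Set.mul_mem_mul (Or.inr hg) hx) f
    refine this.trans (le_of_eq ?_)
    ring

end mean

/-! ### A submultiplicative matrix norm -/

section entrySum

variable {n : ℕ}

/-- The sum of the absolute values of the entries of a matrix. -/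
def entrySum (x : Matrix (Fin n) (Fin n) ℝ) : ℝ := ∑ i, ∑ j, |x i j|

theorem entrySum_nonneg (x : Matrix (Fin n) (Fin n) ℝ) : 0 ≤ entrySum x :=
  Finset.sum_nonneg fun _ _ => Finset.sum_nonneg fun _ _ => abs_nonneg _

theorem abs_le_entrySum (x : Matrix (Fin n) (Fin n) ℝ) (i j : Fin n) : |x i j| ≤ entrySum x :=
  (Finset.single_le_sum (f := fun j => |x i j|) (fun _ _ => abs_nonneg _)
    (Finset.mem_univ j)).trans (Finset.single_le_sum (f := fun i => ∑ j, |x i j|)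
      (fun _ _ => Finset.sum_nonneg fun _ _ => abs_nonneg _) (Finset.mem_univ i))

theorem entrySum_le {x : Matrix (Fin n) (Fin n) ℝ} {M : ℝ} (h : ∀ i j, |x i j| ≤ M) :
    entrySum x ≤ n * (n * M) := by
  calc entrySum x ≤ ∑ _i : Fin n, ∑ _j : Fin n, M :=
        Finset.sum_le_sum fun i _ => Finset.sum_le_sum fun j _ => h i j
    _ = n * (n * M) := by simp

theorem entrySum_add_le (x y : Matrix (Fin n) (Fin n) ℝ) :
    entrySum (x + y) ≤ entrySum x + entrySum y := by
  simp only [entrySum, ← Finset.sum_add_distrib]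
  exact Finset.sum_le_sum fun i _ => Finset.sum_le_sum fun j _ => abs_add_le _ _

theorem entrySum_neg (x : Matrix (Fin n) (Fin n) ℝ) : entrySum (-x) = entrySum x := by
  simp [entrySum]

theorem entrySum_sub_le (x y : Matrix (Fin n) (Fin n) ℝ) :
    entrySum (x - y) ≤ entrySum x + entrySum y := by
  rw [sub_eq_add_neg, ← entrySum_neg y]
  exact entrySum_add_le _ _

theorem entrySum_mul_le (x y : Matrix (Fin n) (Fin n) ℝ) :
    entrySum (x * y) ≤ entrySum x * entrySum y := by
  calc entrySum (x * y) ≤ ∑ i, ∑ j, ∑ k, |x i k| * |y k j| :=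
        Finset.sum_le_sum fun i _ => Finset.sum_le_sum fun j _ => by
          rw [Matrix.mul_apply]
          refine (Finset.abs_sum_le_sum_abs _ _).trans (le_of_eq ?_)
          simp only [abs_mul]
    _ = ∑ i, ∑ k, |x i k| * ∑ j, |y k j| := by
        refine Finset.sum_congr rfl fun i _ => ?_
        rw [Finset.sum_comm]
        simp only [Finset.mul_sum]
    _ ≤ ∑ i, ∑ k, |x i k| * entrySum y := by
        refine Finset.sum_le_sum fun i _ => Finset.sum_le_sum fun k _ =>
          mul_le_mul_of_nonneg_left ?_ (abs_nonneg _)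
        exact Finset.single_le_sum (f := fun k => ∑ j, |y k j|)
          (fun _ _ => Finset.sum_nonneg fun _ _ => abs_nonneg _) (Finset.mem_univ k)
    _ = entrySum x * entrySum y := by
        simp only [entrySum, ← Finset.sum_mul]

theorem continuous_entrySum : Continuous (entrySum : Matrix (Fin n) (Fin n) ℝ → ℝ) := by
  unfold entrySum
  fun_prop

theorem exists_entrySum_sub_one_lt_of_mem_nhds {X : Set (Matrix (Fin n) (Fin n) ℝ)}
    (hX : X ∈ nhds 1) :
    ∃ e : ℕ, 0 < e ∧ ∀ x, entrySum (x - 1) < 1 / e → x ∈ X := by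
  have hX' : X ∈ @nhds (Fin n → Fin n → ℝ) _ (1 : Matrix (Fin n) (Fin n) ℝ) := hX
  obtain ⟨δ, hδ, hball⟩ := Metric.mem_nhds_iff.1 hX'
  obtain ⟨e, he⟩ := exists_nat_one_div_lt hδ
  refine ⟨e + 1, Nat.succ_pos e, fun x hx => hball ?_⟩
  push_cast at hx
  refine (dist_pi_lt_iff hδ).2 fun i => (dist_pi_lt_iff hδ).2 fun j => ?_
  rw [Real.dist_eq]
  exact (abs_le_entrySum (x - 1) i j).trans_lt (hx.trans he)

end entrySum

/-! ### Polynomial growth of the Zariski closure -/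

section growth

variable {n : ℕ} {Γ : Subgroup (GL (Fin n) ℝ)}

open scoped Pointwise in
/-- Words of length `k` in a compact set have entries of polynomial size in `k`. -/
theorem exists_entrySum_pow_le
    (hΓ : Bornology.IsBounded ((fun γ : GL (Fin n) ℝ => γ.val.trace) '' (Γ : Set (GL (Fin n) ℝ))))
    {S : Set (zariskiClosure Γ)} (hS : IsCompact S) :
    ∃ (C : ℝ) (D : ℕ), ∀ k : ℕ, ∀ g ∈ S ^ k, entrySum g.val.val ≤ C * ((k : ℝ) + 1) ^ D := by
  obtain ⟨c, hc, M₀, hM₀⟩ := exists_bounded_projection hΓ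
  obtain ⟨r, hr⟩ := traceRadical_exists_prod_eq_zero Γ
  have henv : ∀ g : zariskiClosure Γ, g.val.val ∈ envelope Γ := fun g =>
    mem_envelope_of_mem_zariskiClosure g.2
  set M : ℝ := n * (n * M₀)
  have hM : ∀ g : zariskiClosure Γ, entrySum (c g.val.val) ≤ M := fun g =>
    entrySum_le (hM₀ _ g.2)
  have hM0 : 0 ≤ M := (entrySum_nonneg _).trans (hM 1)
  obtain ⟨B₀, hB₀⟩ := hS.exists_bound_of_continuousOn (f := fun g => entrySum g.val.val)
    (continuous_entrySum.comp (Units.continuous_val.comp continuous_subtype_val)).continuousOn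
  have hB₀ : ∀ s ∈ S, entrySum s.val.val ≤ B₀ := fun s hs => (le_abs_self _).trans (hB₀ s hs)
  set B : ℝ := |B₀| * M + M
  have hBpos : 0 ≤ B := by positivity
  have hstep : ∀ s ∈ S, ∀ q : zariskiClosure Γ,
      s.val.val * c q.val.val - c (s * q).val.val ∈ traceRadical Γ ∧
        entrySum (s.val.val * c q.val.val - c (s * q).val.val) ≤ B := by
    intro s hs q
    constructor
    · have h1 := mul_traceRadical_mem (hc _ (henv q)) (henv s)
      have h2 := sub_mem (hc _ (henv (s * q))) h1
      have : (s * q).val.val = s.val.val * q.val.val := rfl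
      rw [this] at h2 ⊢
      convert h2 using 1
      noncomm_ring
    · refine (entrySum_sub_le _ _).trans (add_le_add ((entrySum_mul_le _ _).trans ?_) (hM _))
      exact mul_le_mul ((hB₀ s hs).trans (le_abs_self _)) (hM q) (entrySum_nonneg _)
        (abs_nonneg _)
  -- Descending induction on the number i of radical factors to the right of the word: for i = r the
  -- product is zero, and i = 0 is the desired bound.
  have main : ∀ j i : ℕ, i + j = r → ∃ (C : ℝ) (D : ℕ), 0 ≤ C ∧ ∀ k : ℕ, ∀ g ∈ S ^ k,
      ∀ l : List (Matrix (Fin n) (Fin n) ℝ), (∀ a ∈ l, a ∈ traceRadical Γ) → l.length = i →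
        entrySum (g.val.val * l.prod) ≤ C * ((k : ℝ) + 1) ^ D * entrySum l.prod := by
    intro j
    induction j with
    | zero =>
      intro i hi
      refine ⟨0, 0, le_rfl, fun k g _ l hl hli => ?_⟩
      rw [hr l hl (by omega)]
      simp [entrySum]
    | succ j ih =>
      intro i hi
      obtain ⟨C, D, hC, hCD⟩ := ih (i + 1) (by omega)
      have hcons : ∀ k : ℕ, ∀ g ∈ S ^ k, ∀ l : List (Matrix (Fin n) (Fin n) ℝ),
          (∀ a ∈ l, a ∈ traceRadical Γ) → l.length = i → ∀ y ∈ traceRadical Γ,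
          entrySum (g.val.val * (y * l.prod)) ≤
            C * ((k : ℝ) + 1) ^ D * (entrySum y * entrySum l.prod) := by
        intro k g hg l hl hli y hy
        have := hCD k g hg (y :: l) (by simpa using ⟨hy, hl⟩) (by simp [hli])
        rw [List.prod_cons] at this
        exact this.trans (mul_le_mul_of_nonneg_left (entrySum_mul_le _ _) (by positivity))
      -- Telescoping: passing a letter s through replaces s c(q) by c(s q) plus an element of the
      -- radical of bounded size. A word of length k thus leaves one bounded term and k terms with
      -- an extra radical factor, which raises the degree by one.
      have htel : ∀ l : List (Matrix (Fin n) (Fin n) ℝ),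
          (∀ a ∈ l, a ∈ traceRadical Γ) → l.length = i → ∀ k : ℕ, ∀ p ∈ S ^ k,
          ∀ q : zariskiClosure Γ, entrySum (p.val.val * (c q.val.val * l.prod)) ≤
            (M + k * (C * ((k : ℝ) + 1) ^ D * B)) * entrySum l.prod := by
        intro l hl hli k
        induction k with
        | zero =>
          intro p hp q
          rw [pow_zero, Set.mem_one] at hp
          subst hp
          simp only [Subgroup.coe_one, Units.val_one, one_mul, Nat.cast_zero, zero_mul, add_zero]
          exact (entrySum_mul_le _ _).trans
            (mul_le_mul_of_nonneg_right (hM q) (entrySum_nonneg _))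
        | succ k ihk =>
          intro p' hp' q
          rw [pow_succ] at hp'
          obtain ⟨p, hp, s, hs, rfl⟩ := Set.mem_mul.1 hp'
          obtain ⟨hy, hyB⟩ := hstep s hs q
          have h1 : (p * s).val.val * (c q.val.val * l.prod) =
              p.val.val * (c (s * q).val.val * l.prod) +
              p.val.val * ((s.val.val * c q.val.val - c (s * q).val.val) * l.prod) := by
            have : (p * s).val.val = p.val.val * s.val.val := rfl
            rw [this]
            noncomm_ring
          have h2 := ihk p hp (s * q)
          have h3 := hcons k p hp l hl hli _ hy
          have h4 := entrySum_nonneg l.prod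
          have h5 : entrySum (p.val.val * ((s.val.val * c q.val.val - c (s * q).val.val) * l.prod))
              ≤ C * ((k : ℝ) + 1) ^ D * B * entrySum l.prod := by
            refine h3.trans ?_
            rw [mul_assoc (C * _)]
            exact mul_le_mul_of_nonneg_left (mul_le_mul_of_nonneg_right hyB h4) (by positivity)
          have h6 : ((k : ℝ) + 1) ^ D ≤ (((k + 1 : ℕ) : ℝ) + 1) ^ D :=
            pow_le_pow_left₀ (by positivity) (by push_cast; linarith) D
          have h7 : C * ((k : ℝ) + 1) ^ D * B ≤ C * (((k + 1 : ℕ) : ℝ) + 1) ^ D * B :=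
            mul_le_mul_of_nonneg_right (mul_le_mul_of_nonneg_left h6 hC) hBpos
          rw [h1]
          refine (entrySum_add_le _ _).trans ((add_le_add h2 h5).trans ?_)
          rw [← add_mul]
          refine mul_le_mul_of_nonneg_right ?_ h4
          have h8 : (k : ℝ) * (C * ((k : ℝ) + 1) ^ D * B) ≤
              k * (C * (((k + 1 : ℕ) : ℝ) + 1) ^ D * B) :=
            mul_le_mul_of_nonneg_left h7 (Nat.cast_nonneg k)
          have h9 : (((k + 1 : ℕ) : ℝ)) * (C * (((k + 1 : ℕ) : ℝ) + 1) ^ D * B) =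
              k * (C * (((k + 1 : ℕ) : ℝ) + 1) ^ D * B) + C * (((k + 1 : ℕ) : ℝ) + 1) ^ D * B := by
            push_cast; ring
          linarith
      set e := entrySum ((1 : Matrix (Fin n) (Fin n) ℝ) - c 1)
      have he : 0 ≤ e := entrySum_nonneg _
      refine ⟨M + C * B + C * e, D + 1, by positivity, fun k g hg l hl hli => ?_⟩
      have h1 : g.val.val * l.prod = g.val.val * (c 1 * l.prod) +
          g.val.val * ((1 - c 1) * l.prod) := by noncomm_ring
      have h2 := htel l hl hli k g hg 1
      have h3 := hcons k g hg l hl hli _ (hc 1 (one_mem _))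
      rw [h1]
      refine (entrySum_add_le _ _).trans ((add_le_add h2 h3).trans ?_)
      rw [← mul_assoc (C * ((k : ℝ) + 1) ^ D), ← add_mul]
      refine mul_le_mul_of_nonneg_right ?_ (entrySum_nonneg _)
      have hk : (0 : ℝ) ≤ k := Nat.cast_nonneg k
      have h4 : 1 ≤ ((k : ℝ) + 1) ^ D := one_le_pow₀ (by linarith)
      rw [pow_succ]
      set P := ((k : ℝ) + 1) ^ D
      have h5 : M ≤ M * (P * (k + 1)) := le_mul_of_one_le_right hM0 (by nlinarith)
      have h6 : k * (C * P * B) ≤ C * B * (P * (k + 1)) := by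
        have : 0 ≤ C * P * B := by positivity
        nlinarith
      have h7 : C * P * e ≤ C * e * (P * (k + 1)) := by
        have : 0 ≤ C * P * e * k := by positivity
        nlinarith
      change M + k * (C * P * B) + C * P * e ≤ _
      linarith
  obtain ⟨C, D, hC, hCD⟩ := main r 0 (zero_add r)
  refine ⟨C * entrySum (1 : Matrix (Fin n) (Fin n) ℝ), D, fun k g hg => ?_⟩
  have := hCD k g hg [] (by simp) rfl
  rw [List.prod_nil, mul_one] at this
  linarith

instance : LocallyCompactSpace (Matrix (Fin n) (Fin n) ℝ) :=
  inferInstanceAs (LocallyCompactSpace (Fin n → Fin n → ℝ))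

instance : LocallyCompactSpace (zariskiClosure Γ) :=
  (isClosed_zariskiClosureSet (Γ : Set (GL (Fin n) ℝ))).isClosedEmbedding_subtypeVal.locallyCompactSpace

open MeasureTheory

/-- Balls in a closed linear group have polynomially bounded Haar measure. -/
theorem exists_measure_ball_le [MeasurableSpace (zariskiClosure Γ)] [BorelSpace (zariskiClosure Γ)]
    (μ : Measure (zariskiClosure Γ)) [μ.IsHaarMeasure] :
    ∃ (e : ℕ) (V : ℝ), 0 ≤ V ∧ ∀ R : ℕ, 0 < R →
      μ {g | entrySum g.val.val ≤ R ∧ entrySum (g⁻¹).val.val ≤ R} ≠ ⊤ ∧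
      μ.real {g | entrySum g.val.val ≤ R ∧ entrySum (g⁻¹).val.val ≤ R} ≤
        (2 * (e * R ^ 2 * (n * n + 1)) + 1 : ℕ) ^ (n * n) * V := by
  set X : Set (GL (Fin n) ℝ) := {g | (∀ i j, |g.val i j| ≤ 2) ∧ 1 / 2 ≤ |g.val.det|}
  have hX : IsCompact X := isCompact_gl_entries_le 2 (by norm_num)
  set V : Set (zariskiClosure Γ) := Subtype.val ⁻¹' X
  have hV : IsCompact V :=
    (isClosed_zariskiClosureSet (Γ : Set (GL (Fin n) ℝ))).isClosedEmbedding_subtypeVal.isCompact_preimage hX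
  have hnhds : {x : Matrix (Fin n) (Fin n) ℝ | (∀ i j, |x i j| < 2) ∧ 1 / 2 < |x.det|} ∈ nhds 1 := by
    refine IsOpen.mem_nhds ?_ ⟨fun i j => ?_, ?_⟩
    · simp only [Set.ofPred_and, Set.ofPred_forall]
      exact (isOpen_iInter_of_finite fun i => isOpen_iInter_of_finite fun j =>
        isOpen_lt (by fun_prop) continuous_const).inter
        (isOpen_lt continuous_const continuous_id.matrix_det.abs)
    · rw [Matrix.one_apply]; split_ifs <;> norm_num
    · simp; norm_num
  obtain ⟨e, he0, he⟩ := exists_entrySum_sub_one_lt_of_mem_nhds hnhds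
  have heV : ∀ g : zariskiClosure Γ, entrySum (g.val.val - 1) < 1 / e → g ∈ V := fun g hg =>
    ⟨fun i j => ((he _ hg).1 i j).le, (he _ hg).2.le⟩
  refine ⟨e, μ.real V, measureReal_nonneg, fun R hR => ?_⟩
  set K : ℕ := e * R ^ 2 * (n * n + 1)
  -- The mesh is chosen so that R n² η < 1/e; n² + 1 keeps the denominator positive for n = 0.
  set η : ℝ := 1 / (e * R * (n * n + 1))
  have hR' : (0 : ℝ) < R := Nat.cast_pos.2 hR
  have he' : (0 : ℝ) < e := Nat.cast_pos.2 he0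
  have hη : 0 < η := by positivity
  have hKη : (R : ℝ) / η = K := by
    simp only [η, K]
    push_cast
    field_simp
  set ball : Set (zariskiClosure Γ) :=
    {g | entrySum g.val.val ≤ R ∧ entrySum (g⁻¹).val.val ≤ R}
  let cell : (Fin n × Fin n → ℤ) → Set (zariskiClosure Γ) := fun φ =>
    {g | g ∈ ball ∧ ∀ ij : Fin n × Fin n, ⌊g.val.val ij.1 ij.2 / η⌋ = φ ij}
  let I : Finset (Fin n × Fin n → ℤ) := Fintype.piFinset fun _ => Finset.Icc (-(K : ℤ)) K
  have hcover : ball ⊆ ⋃ φ ∈ I, cell φ := by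
    intro g hg
    refine Set.mem_biUnion (x := fun ij => ⌊g.val.val ij.1 ij.2 / η⌋) ?_ ⟨hg, fun _ => rfl⟩
    refine Fintype.mem_piFinset.2 fun ij => Finset.mem_Icc.2 ?_
    have h1 := abs_le.1 ((abs_le_entrySum g.val.val ij.1 ij.2).trans hg.1)
    constructor
    · rw [Int.le_floor]
      push_cast
      rw [← hKη, ← neg_div]
      exact div_le_div_of_nonneg_right h1.1 hη.le
    · have h2 : g.val.val ij.1 ij.2 / η ≤ K := by
        rw [← hKη]
        exact div_le_div_of_nonneg_right h1.2 hη.le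
      have h3 : (⌊g.val.val ij.1 ij.2 / η⌋ : ℝ) ≤ (K : ℝ) := (Int.floor_le _).trans h2
      exact_mod_cast h3
  -- If g and g₀ share a cell, then g₀⁻¹ g is near 1, because g₀⁻¹ has size at most R. So the cell
  -- lies in the left translate g₀ V.
  have hcell : ∀ φ, μ (cell φ) ≤ μ V := by
    intro φ
    rcases (cell φ).eq_empty_or_nonempty with h0 | ⟨g₀, hg₀⟩
    · rw [h0, measure_empty]; exact bot_le
    · rw [← measure_preimage_mul μ g₀⁻¹ V]
      refine measure_mono fun g hg => heV _ ?_
      have h1 : (g₀⁻¹ * g).val.val - 1 = (g₀⁻¹).val.val * (g.val.val - g₀.val.val) := by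
        have e1 : (g₀⁻¹).val.val * g₀.val.val = 1 :=
          congrArg (fun x : zariskiClosure Γ => x.val.val) (inv_mul_cancel g₀)
        rw [mul_sub, e1]
        rfl
      have h2 : entrySum (g.val.val - g₀.val.val) ≤ n * (n * η) := by
        refine entrySum_le fun i j => ?_
        have h3 := Int.abs_sub_lt_one_of_floor_eq_floor
          ((hg.2 (i, j)).trans (hg₀.2 (i, j)).symm)
        rw [← sub_div, abs_div, abs_of_pos hη, div_lt_one hη] at h3
        exact h3.le
      rw [h1]
      refine (entrySum_mul_le _ _).trans_lt ((mul_le_mul hg₀.1.2 h2 (entrySum_nonneg _)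
        hR'.le).trans_lt ?_)
      simp only [η]
      rw [← sub_pos]
      have : (1 : ℝ) / e - R * (n * (n * (1 / (e * R * (n * n + 1))))) =
          1 / (e * (n * n + 1)) := by
        field_simp
        ring
      rw [this]
      positivity
  have h1 : μ ball ≤ (I.card : ENNReal) * μ V := by
    calc μ ball ≤ ∑ φ ∈ I, μ (cell φ) := (measure_mono hcover).trans (measure_biUnion_finset_le _ _)
      _ ≤ ∑ _φ ∈ I, μ V := Finset.sum_le_sum fun φ _ => hcell φ
      _ = _ := by rw [Finset.sum_const, nsmul_eq_mul]
  have hcard : I.card = (2 * K + 1) ^ (n * n) := by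
    simp only [I]
    rw [Fintype.card_piFinset]
    simp only [Int.card_Icc, Finset.prod_const, Finset.card_univ, Fintype.card_prod,
      Fintype.card_fin]
    congr 1
    omega
  have htop : (I.card : ENNReal) * μ V ≠ ⊤ :=
    ENNReal.mul_ne_top (ENNReal.natCast_ne_top _) hV.measure_lt_top.ne
  have h2 := ENNReal.toReal_mono htop h1
  rw [ENNReal.toReal_mul, ENNReal.toReal_natCast, hcard] at h2
  refine ⟨ne_top_of_le_ne_top htop h1, ?_⟩
  exact_mod_cast h2

/-- The Zariski closure of a linear group with bounded traces is amenable. -/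
theorem isAmenable_zariskiClosure
    (hΓ : Bornology.IsBounded ((fun γ : GL (Fin n) ℝ => γ.val.trace) '' (Γ : Set (GL (Fin n) ℝ)))) :
    IsAmenable (zariskiClosure Γ) := by
  let _ : MeasurableSpace (zariskiClosure Γ) := borel _
  have : BorelSpace (zariskiClosure Γ) := ⟨rfl⟩
  open scoped Pointwise in
  refine isAmenable_of_polynomial_growth Measure.haar fun S hS => ?_
  -- Symmetrizing `S` controls inverses of words too, as the balls require.
  obtain ⟨C, D, hCD⟩ := exists_entrySum_pow_le hΓ (hS.union hS.inv)
  obtain ⟨e, V, hV, hball⟩ := exists_measure_ball_le (Γ := Γ) Measure.haar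
  -- Adding 1 makes the radius `R` below positive.
  set A : ℕ := ⌈|C|⌉₊ + 1
  have hAC : C ≤ A := by
    have := Nat.le_ceil |C|
    push_cast [A]
    linarith [le_abs_self C]
  have hsymm : (S ∪ S⁻¹)⁻¹ = S ∪ S⁻¹ := by
    rw [Set.union_inv, inv_inv, Set.union_comm]
  refine ⟨(2 * (e * A ^ 2 * (n * n + 1)) + 1 : ℕ) ^ (n * n) * V, 2 * D * (n * n), fun k => ?_⟩
  set R : ℕ := A * (k + 1) ^ D
  have hword : ∀ g ∈ (S ∪ S⁻¹) ^ k, entrySum g.val.val ≤ R := fun g hg => by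
    refine (hCD k g hg).trans ?_
    push_cast [R]
    exact mul_le_mul_of_nonneg_right hAC (by positivity)
  have hsub : S ^ k ⊆ {g : zariskiClosure Γ | entrySum g.val.val ≤ R ∧
      entrySum (g⁻¹).val.val ≤ R} := by
    intro g hg
    have h1 : g ∈ (S ∪ S⁻¹) ^ k := Set.pow_subset_pow_left Set.subset_union_left hg
    refine ⟨hword g h1, hword _ ?_⟩
    rw [← hsymm, inv_pow]
    exact Set.inv_mem_inv.2 h1
  obtain ⟨hfin, hle⟩ := hball R (by positivity)
  refine (measureReal_mono hsub hfin).trans (hle.trans ?_)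
  rw [mul_right_comm _ V]
  refine mul_le_mul_of_nonneg_right ?_ hV
  rw [pow_mul _ (2 * D), ← mul_pow]
  refine pow_le_pow_left₀ (by positivity) ?_ _
  have h1 : 2 * (e * R ^ 2 * (n * n + 1)) + 1 ≤
      (2 * (e * A ^ 2 * (n * n + 1)) + 1) * (k + 1) ^ (2 * D) := by
    have h2 : R ^ 2 = A ^ 2 * (k + 1) ^ (2 * D) := by
      rw [mul_pow, ← pow_mul, mul_comm D]
    have h3 : 1 ≤ (k + 1) ^ (2 * D) := Nat.one_le_pow _ _ (Nat.succ_pos k)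
    rw [h2]
    linarith
  exact_mod_cast h1

end growth

theorem lemma6p6 (n : ℕ) (Γ : Subgroup (GL (Fin n) ℝ))
    (hΓ : Bornology.IsBounded ((fun γ : GL (Fin n) ℝ => γ.val.trace) '' (Γ : Set (GL (Fin n) ℝ)))) :
    IsAmenable (zariskiClosure Γ) ∧
    IsUnipotentSubgroup (unipotentRadical (zariskiClosure Γ)) ∧
    IsZariskiClosed
      (((unipotentRadical (zariskiClosure Γ)).map (zariskiClosure Γ).subtype :
        Subgroup (GL (Fin n) ℝ)) : Set (GL (Fin n) ℝ)) ∧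
    CompactSpace (zariskiClosure Γ ⧸ unipotentRadical (zariskiClosure Γ)) :=
  ⟨isAmenable_zariskiClosure hΓ, isUnipotentSubgroup_unipotentRadical Γ,
    isZariskiClosed_unipotentRadical Γ, compactSpace_quotient_unipotentRadical hΓ⟩
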